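/- For $f\in L^1(\mathbb R^d)$ let $\widehat f(\xi)=\int_{\mathbb R^d} f(x)e^{-2\pi i x\cdot\xi}\,dx$, extended in the usual way to complex-valued $f\in L^p(\mathbb R^d)$, $1\le p\le 2$. Let $\psi:[0,\infty)\to[0,\infty)$ be a locally integrable function and put $$I=\int_1^\infty \frac{\psi(t)}{t^2}\,dt\in[0,\infty].$$ For a unit vector $\eta\in S^{d-1}\subset\mathbb R^d$, consider the estimates $$(1)\quad \int_{\mathbb R^d}\frac{|\widehat f(\xi)|^q\,e^{q\psi(|\xi\cdot\eta|)}}{(1+\|\xi\|)^N}\,d\xi<\infty,\qquad\qquad (2)\quad |\widehat f(\xi)|\le C(1+\|\xi\|)^N e^{-\psi(|\xi\cdot\eta|)}\ \text{ for almost every }\xi\in\mathbb R^d.$$ (a) Let $p\in[1,2]$, let $f\in L^p(\mathbb R^d)$, let $\eta\in S^{d-1}$ and $s\in\mathbb R$, and suppose that $\operatorname{supp} f\subseteq\{x\in\mathbb R^d : x\cdot\eta\le s\}$ (that is, $f(x)=0$ for almost every $x$ with $x\cdot\eta>s$). Suppose that $\widehat f$ satisfies (1) for some $q\in[1,\infty)$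 and some $N\ge 0$, or that $\widehat f$ satisfies (2) for some constant $C$ and some $N\ge 0$. If $I=\infty$, then $f=0$ almost everywhere. (b) If $\psi$ is non-decreasing and $I<\infty$, then there is a continuous compactly supported function $f:\mathbb R^d\to\mathbb C$, not identically zero, which satisfies (1) for all $q\in[1,\infty)$, all $N\ge 0$ and all $\eta\in S^{d-1}$, and which satisfies, for every $N\ge 0$, the estimate (2) for all $\eta\in S^{d-1}$ with a constant $C$ that does not depend on $\eta$. -/

import Mathlib

open MeasureTheory Set
open scoped ENNReal FourierTransform RealInnerProductSpace

noncomputable section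

namespace PaleyWiener

/-- The part of a function where it is larger than `1`. -/
def large {E : Type*} (f : E → ℂ) : E → ℂ := {x | 1 < ‖f x‖}.indicator f

/-- The part of a function where it is at most `1`; thus `f = large f + small f`. -/
def small {E : Type*} (f : E → ℂ) : E → ℂ := {x | ‖f x‖ ≤ 1}.indicator f

theorem large_add_small {E : Type*} (f : E → ℂ) : large f + small f = f := by
  funext x
  by_cases h : ‖f x‖ ≤ 1
  · simp [large, small, h]
  · simp [large, small, h, not_le.mp h]

/-- A bound `‖g‖ ^ r ≤ ‖f‖ ^ p` transfers integrability. -/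
theorem memLp_of_rpow_le {E : Type*} [MeasurableSpace E] {μ : Measure E} {f g : E → ℂ}
    {p r : ℝ≥0∞} (hp0 : p ≠ 0) (hp : p ≠ ∞) (hr0 : r ≠ 0) (hr : r ≠ ∞)
    (hf : MemLp f p μ) (hg : AEStronglyMeasurable g μ)
    (h : ∀ x, ‖g x‖ₑ ^ r.toReal ≤ ‖f x‖ₑ ^ p.toReal) : MemLp g r μ := by
  refine ⟨hg, ?_⟩
  rw [eLpNorm_lt_top_iff_lintegral_rpow_enorm_lt_top hr0 hr]
  exact (lintegral_mono h).trans_lt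
    ((eLpNorm_lt_top_iff_lintegral_rpow_enorm_lt_top hp0 hp).1 hf.2)

/-- For `f ∈ L^p` with `1 ≤ p ≤ 2`, the large part is integrable. -/
theorem memLp_large {E : Type*} [MeasurableSpace E] {μ : Measure E} {p : ℝ≥0∞}
    (hp1 : 1 ≤ p) (hp2 : p ≤ 2) (f : Lp ℂ p μ) : MemLp (large f) 1 μ := by
  have hp : p ≠ ∞ := ne_top_of_le_ne_top (by simp) hp2
  have hp0 : p ≠ 0 := (zero_lt_one.trans_le hp1).ne'
  have hm := Lp.stronglyMeasurable f
  refine memLp_of_rpow_le hp0 hp one_ne_zero ENNReal.one_ne_top (Lp.memLp f)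
    (hm.indicator (measurableSet_lt measurable_const hm.norm.measurable)).aestronglyMeasurable
    fun x ↦ ?_
  by_cases h : 1 < ‖f x‖
  · have h1 : (1 : ℝ) ≤ p.toReal := by simpa using ENNReal.toReal_mono hp hp1
    have h2 : (1 : ℝ≥0∞) ≤ ‖f x‖ₑ := by
      rw [← ofReal_norm, ENNReal.one_le_ofReal]; exact h.le
    simpa [large, h] using ENNReal.rpow_le_rpow_of_exponent_le h2 h1
  · simp [large, h]

/-- For `f ∈ L^p` with `1 ≤ p ≤ 2`, the small part is square integrable. -/
theorem memLp_small {E : Type*} [MeasurableSpace E] {μ : Measure E} {p : ℝ≥0∞}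
    (hp1 : 1 ≤ p) (hp2 : p ≤ 2) (f : Lp ℂ p μ) : MemLp (small f) 2 μ := by
  have hp : p ≠ ∞ := ne_top_of_le_ne_top (by simp) hp2
  have hp0 : p ≠ 0 := (zero_lt_one.trans_le hp1).ne'
  have hm := Lp.stronglyMeasurable f
  refine memLp_of_rpow_le hp0 hp two_ne_zero ENNReal.ofNat_ne_top (Lp.memLp f)
    (hm.indicator (measurableSet_le hm.norm.measurable measurable_const)).aestronglyMeasurable
    fun x ↦ ?_
  by_cases h : ‖f x‖ ≤ 1
  · have h1 : p.toReal ≤ (2 : ℝ≥0∞).toReal := ENNReal.toReal_mono (by simp) hp2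
    have h2 : ‖f x‖ₑ ≤ 1 := by
      rw [← ofReal_norm, ENNReal.ofReal_le_one]; exact h
    have h3 : small f x = f x := by simp [small, h]
    rw [h3]
    exact ENNReal.rpow_le_rpow_of_exponent_ge h2 h1
  · simp [small, h]

/-- The Fourier transform of `f ∈ L^p(ℝ^d)`, `1 ≤ p ≤ 2`, normalised by the kernel
`exp (-2πi x·ξ)`: split `f` into an integrable and a square integrable function, transform the
first by the Fourier integral and the second by Plancherel's isometry of `L²`.
(As always in `L¹ + L²`, the result does not depend, up to null sets, on the splitting.) -/
def fourierLp {d : ℕ} {p : ℝ≥0∞} (hp1 : 1 ≤ p) (hp2 : p ≤ 2)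
    (f : Lp ℂ p (volume : Measure (EuclideanSpace ℝ (Fin d)))) :
    EuclideanSpace ℝ (Fin d) → ℂ :=
  fun ξ ↦ 𝓕 (large f) ξ +
    (𝓕 ((memLp_small hp1 hp2 f).toLp (small f)) :
      Lp ℂ 2 (volume : Measure (EuclideanSpace ℝ (Fin d)))) ξ

/-- `I = ∫_1^∞ ψ(t) / t² dt`, with values in `[0, ∞]` (for `ψ ≥ 0`). -/
def logIntegral (ψ : ℝ → ℝ) : ℝ≥0∞ := ∫⁻ t in Ioi (1 : ℝ), ENNReal.ofReal (ψ t / t ^ 2)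

/-- `∫ |g(ξ)|^q e^{q ψ(|ξ·η|)} / (1 + ‖ξ‖)^N dξ < ∞`. -/
def WeightedLq {d : ℕ} (ψ : ℝ → ℝ) (η : EuclideanSpace ℝ (Fin d)) (q N : ℝ)
    (g : EuclideanSpace ℝ (Fin d) → ℂ) : Prop :=
  ∫⁻ ξ, ENNReal.ofReal (‖g ξ‖ ^ q * Real.exp (q * ψ |⟪ξ, η⟫|) / (1 + ‖ξ‖) ^ N) < ∞

/-- `|g(ξ)| ≤ C (1 + ‖ξ‖)^N e^{-ψ(|ξ·η|)}` for almost every `ξ`. -/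
def PointwiseDecay {d : ℕ} (ψ : ℝ → ℝ) (η : EuclideanSpace ℝ (Fin d)) (C N : ℝ)
    (g : EuclideanSpace ℝ (Fin d) → ℂ) : Prop :=
  ∀ᵐ ξ, ‖g ξ‖ ≤ C * (1 + ‖ξ‖) ^ N * Real.exp (-ψ |⟪ξ, η⟫|)

end PaleyWiener

end

noncomputable section

namespace PaleyWiener

set_option linter.unusedSectionVars false

/-! ### Analytic multipliers acting on functions with one-sided spectrum. -/

section Multipliers

variable {V : Type*} [NormedAddCommGroup V] [InnerProductSpace ℝ V] [FiniteDimensional ℝ V]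
  [MeasurableSpace V] [BorelSpace V]

/-! Uniqueness is a Jensen inequality in a half-plane, proved in the direction η without boundary
values of Hardy functions. Multiply the transform of f by the inverse transform of a test function
g. The product h is integrable, and 𝓕⁻ h, a correlation of f with g, vanishes far out in direction η
(`halfSpectrum_fourierLp_mul`). So the Laplace transform J(l) of 𝓕⁻ h along a line parallel to η is
bounded by a constant times ‖h‖₁ when Re l > 0. Multiplying h by exp(2πiuτ), with u ≥ 0 and τ = ⟪ξ,
η⟫, translates 𝓕⁻ h in the harmless direction and multiplies J(l) by exp(-2πlu), the value of the
character at τ = il. Superposition and the exponential series extend this to outer functions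
(`IsMultiplier.integral`, `IsMultiplier.exp`, `isMultiplier_herglotz`). The L¹ bound for the
multiplied function then reads |J(l)| exp(Poisson integral of φ) ≤ K ∫ |h| exp φ(⟪ξ, η⟫)
(`HalfSpectrum.norm_lineLaplace_mul_exp_le_of_bounded`).

For truncations φ of ψ(|t|) the right side stays bounded, by the decay hypothesis and the rapid
decay of 𝓕⁻ g. If I = ∞ the Poisson integrals are unbounded, so J = 0
(`HalfSpectrum.lineLaplace_eq_zero`). Fourier inversion on Re l = 1 gives 𝓕⁻ h = 0, and its value at
0 is ∫ f g. As g is arbitrary, f = 0.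

For existence, take an infinite product of dilates of the transform of a bump density. The factor at
scale 2^j, raised to the power n j ≥ ψ(2^(j+1)), supplies decay exp(-n j) for ‖ξ‖ ≥ 2^j and enlarges
the support radius by a multiple of n j / 2^j. For monotone ψ, I < ∞ makes these radii summable
(`summable_of_logIntegral_lt_top`, `exists_fourier_dyadic_decay`). -/

theorem fourierInv_eq_integral_exp (h : V → ℂ) (x : V) :
    𝓕⁻ h x = ∫ ξ, Complex.exp (2 * Real.pi * Complex.I * ⟪ξ, x⟫) * h ξ := by
  rw [Real.fourierInv_eq']
  congr 1; ext ξ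
  rw [smul_eq_mul]; congr 2; push_cast; ring

theorem norm_exp_two_pi_I (t : ℝ) : ‖Complex.exp (2 * Real.pi * Complex.I * t)‖ = 1 := by
  have : 2 * Real.pi * Complex.I * t = ((2 * Real.pi * t : ℝ) : ℂ) * Complex.I := by
    push_cast; ring
  rw [this, Complex.norm_exp_ofReal_mul_I]

theorem norm_fourierInv_le (h : V → ℂ) (x : V) : ‖𝓕⁻ h x‖ ≤ ∫ ξ, ‖h ξ‖ := by
  rw [fourierInv_eq_integral_exp]
  refine (norm_integral_le_integral_norm _).trans_eq ?_
  congr 1; ext ξ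
  rw [norm_mul, norm_exp_two_pi_I, one_mul]

theorem continuous_fourierInv {h : V → ℂ} (hh : Integrable h) : Continuous (𝓕⁻ h) := by
  have h1 : Continuous (𝓕 h) :=
    VectorFourier.fourierIntegral_continuous Real.continuous_fourierChar
      (L := innerₗ V) (by exact continuous_inner) hh
  have : 𝓕⁻ h = fun x ↦ 𝓕 h (-x) := by
    ext x; exact Real.fourierInv_eq_fourier_neg h x
  rw [this]; exact h1.comp continuous_neg

/-- `h` is integrable and its inverse Fourier transform vanishes where `s < ⟪x, η⟫`. -/
structure HalfSpectrum (η : V) (s : ℝ) (h : V → ℂ) : Prop where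
  integrable : Integrable h
  vanish : ∀ x, s < ⟪x, η⟫ → 𝓕⁻ h x = 0

/-- The two-sided Laplace transform of `𝓕⁻ h` along the line through `x₀` in direction `η`. -/
def lineLaplace (η x₀ : V) (l : ℂ) (h : V → ℂ) : ℂ :=
  ∫ u : ℝ, Complex.exp (2 * Real.pi * l * u) * 𝓕⁻ h (x₀ + u • η)

theorem inner_add_smul_self {η : V} (hη : ‖η‖ = 1) (x : V) (u : ℝ) :
    ⟪x + u • η, η⟫ = ⟪x, η⟫ + u := by
  rw [inner_add_left, real_inner_smul_left, real_inner_self_eq_norm_sq, hη]; ring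

/-- The envelope of the integrand in `lineLaplace`. -/
def envelope (b a : ℝ) : ℝ → ℝ := (Iic a).indicator fun u ↦ Real.exp (2 * Real.pi * b * u)

theorem integrable_envelope {b : ℝ} (hb : 0 < b) (a : ℝ) : Integrable (envelope b a) := by
  rw [envelope, integrable_indicator_iff measurableSet_Iic]
  exact integrableOn_exp_mul_Iic (by positivity) a

theorem norm_exp_mul_real (l : ℂ) (u : ℝ) :
    ‖Complex.exp (2 * Real.pi * l * u)‖ = Real.exp (2 * Real.pi * l.re * u) := by
  rw [Complex.norm_exp]; congr 1
  have : 2 * Real.pi * l * u = ((2 * Real.pi * u : ℝ) : ℂ) * l := by push_cast; ring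
  rw [this, Complex.re_ofReal_mul]; ring

theorem HalfSpectrum.norm_le_envelope {η : V} {s : ℝ} {h : V → ℂ} (hh : HalfSpectrum η s h)
    (hη : ‖η‖ = 1) (x₀ : V) (l : ℂ) (u : ℝ) :
    ‖Complex.exp (2 * Real.pi * l * u) * 𝓕⁻ h (x₀ + u • η)‖ ≤
      envelope l.re (s - ⟪x₀, η⟫) u * ∫ ξ, ‖h ξ‖ := by
  by_cases hu : u ≤ s - ⟪x₀, η⟫
  · rw [envelope, indicator_of_mem (by exact hu), norm_mul, norm_exp_mul_real]
    exact mul_le_mul_of_nonneg_left (norm_fourierInv_le _ _) (Real.exp_pos _).le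
  · rw [hh.vanish _ (by rw [inner_add_smul_self hη]; linarith [not_le.1 hu]), mul_zero, norm_zero]
    exact mul_nonneg (indicator_nonneg (fun _ _ ↦ (Real.exp_pos _).le) _)
      (integral_nonneg fun _ ↦ norm_nonneg _)

/-- The factor in front of the L¹ norm does not depend on `h`, so the same bound can be applied
after multiplying `h` by an outer function. -/
theorem HalfSpectrum.norm_lineLaplace_le {η : V} {s : ℝ} {h : V → ℂ} (hh : HalfSpectrum η s h)
    (hη : ‖η‖ = 1) (x₀ : V) {l : ℂ} (hl : 0 < l.re) :
    ‖lineLaplace η x₀ l h‖ ≤ (∫ u, envelope l.re (s - ⟪x₀, η⟫) u) * ∫ ξ, ‖h ξ‖ := by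
  rw [← integral_mul_const]
  exact norm_integral_le_of_norm_le ((integrable_envelope hl _).mul_const _)
    (Filter.Eventually.of_forall (hh.norm_le_envelope hη x₀ l))

/-- Multiplication by `b ⟪·, η⟫` preserves `HalfSpectrum η s` and multiplies the Laplace transform
at `l` by `c`. -/
structure IsMultiplier (η : V) (s : ℝ) (x₀ : V) (l : ℂ) (b : ℝ → ℂ) (c : ℂ) : Prop where
  measurable : Measurable b
  bounded : ∃ C, ∀ τ, ‖b τ‖ ≤ C
  map : ∀ h, HalfSpectrum η s h → HalfSpectrum η s fun ξ ↦ b ⟪ξ, η⟫ * h ξ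
  laplace : ∀ h, HalfSpectrum η s h →
    lineLaplace η x₀ l (fun ξ ↦ b ⟪ξ, η⟫ * h ξ) = c * lineLaplace η x₀ l h

theorem integrable_comp_inner_mul {b : ℝ → ℂ} (hb : Measurable b) {C : ℝ}
    (hC : ∀ τ, ‖b τ‖ ≤ C) {h : V → ℂ} (hh : Integrable h) (η : V) :
    Integrable fun ξ ↦ b ⟪ξ, η⟫ * h ξ :=
  hh.bdd_mul (c := C) (hb.comp (by fun_prop)).aestronglyMeasurable
    (Filter.Eventually.of_forall fun _ ↦ hC _)

namespace IsMultiplier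

variable {η x₀ : V} {s : ℝ} {l : ℂ}

theorem mul {b₁ b₂ : ℝ → ℂ} {c₁ c₂ : ℂ} (h₁ : IsMultiplier η s x₀ l b₁ c₁)
    (h₂ : IsMultiplier η s x₀ l b₂ c₂) :
    IsMultiplier η s x₀ l (fun τ ↦ b₁ τ * b₂ τ) (c₁ * c₂) := by
  obtain ⟨C₁, hC₁⟩ := h₁.bounded
  obtain ⟨C₂, hC₂⟩ := h₂.bounded
  refine ⟨h₁.measurable.mul h₂.measurable, ⟨C₁ * C₂, fun τ ↦ ?_⟩, fun h hh ↦ ?_, fun h hh ↦ ?_⟩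
  · rw [norm_mul]
    exact mul_le_mul (hC₁ τ) (hC₂ τ) (norm_nonneg _) ((norm_nonneg _).trans (hC₁ τ))
  · simpa only [mul_assoc] using h₁.map _ (h₂.map h hh)
  · have := h₁.laplace _ (h₂.map h hh)
    rw [h₂.laplace h hh] at this
    simpa only [mul_assoc] using this

theorem const (c : ℂ) : IsMultiplier η s x₀ l (fun _ ↦ c) c := by
  have key : ∀ (h : V → ℂ) x, 𝓕⁻ (fun ξ ↦ c * h ξ) x = c * 𝓕⁻ h x := fun h x ↦ by
    simp only [fourierInv_eq_integral_exp]
    rw [← integral_const_mul]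
    congr 1; ext ξ; ring
  refine ⟨measurable_const, ⟨‖c‖, fun _ ↦ le_rfl⟩, fun h hh ↦ ⟨hh.integrable.const_mul c,
    fun x hx ↦ by rw [key, hh.vanish x hx, mul_zero]⟩, fun h hh ↦ ?_⟩
  simp only [lineLaplace, key]
  rw [← integral_const_mul]
  congr 1; ext ξ; ring

theorem pow {b : ℝ → ℂ} {c : ℂ} (h : IsMultiplier η s x₀ l b c) (n : ℕ) :
    IsMultiplier η s x₀ l (fun τ ↦ b τ ^ n) (c ^ n) := by
  induction n with
  | zero => simpa using const 1
  | succ n ih => simpa only [pow_succ] using ih.mul h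

/-- The character translates 𝓕⁻ h by `u • η`. Since `u ≥ 0`, the region of vanishing can only grow,
and a change of variable in the Laplace integral produces the factor. -/
theorem char (hη : ‖η‖ = 1) {u : ℝ} (hu : 0 ≤ u) :
    IsMultiplier η s x₀ l (fun τ ↦ Complex.exp (2 * Real.pi * Complex.I * (u * τ)))
      (Complex.exp (-(2 * Real.pi * l * u))) := by
  have hm : Measurable fun τ : ℝ ↦ Complex.exp (2 * Real.pi * Complex.I * (u * τ)) := by fun_prop
  have hb : ∀ τ : ℝ, ‖Complex.exp (2 * Real.pi * Complex.I * (u * τ))‖ ≤ 1 := fun τ ↦ by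
    have := norm_exp_two_pi_I (u * τ); push_cast at this; exact this.le
  have key : ∀ (h : V → ℂ) x,
      𝓕⁻ (fun ξ ↦ Complex.exp (2 * Real.pi * Complex.I * (u * (⟪ξ, η⟫ : ℝ))) * h ξ) x =
        𝓕⁻ h (x + u • η) := fun h x ↦ by
    simp only [fourierInv_eq_integral_exp]
    congr 1; ext ξ
    rw [← mul_assoc, ← Complex.exp_add, inner_add_right, real_inner_smul_right]
    push_cast; congr 2; ring
  refine ⟨hm, ⟨1, hb⟩, fun h hh ↦ ⟨integrable_comp_inner_mul hm hb hh.integrable η,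
    fun x hx ↦ ?_⟩, fun h hh ↦ ?_⟩
  · rw [key, hh.vanish]
    rw [inner_add_smul_self hη]; linarith
  · simp only [lineLaplace, key]
    rw [← integral_const_mul, ← integral_add_right_eq_self (fun v : ℝ ↦
      Complex.exp (-(2 * Real.pi * l * u)) *
        (Complex.exp (2 * Real.pi * l * v) * 𝓕⁻ h (x₀ + v • η))) u]
    congr 1; ext v
    rw [← mul_assoc, ← Complex.exp_add, add_assoc, ← add_smul]
    congr 2
    push_cast; ring

/-- Fubini, first for 𝓕⁻ and then for the Laplace integral. The majorant `g`, together with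
`envelope` in the second case, gives absolute convergence. -/
theorem integral {α : Type*} [MeasurableSpace α] {μ : Measure α} [SFinite μ] (hη : ‖η‖ = 1)
    (hl : 0 < l.re) {b : α → ℝ → ℂ} {c : α → ℂ} {g : α → ℝ}
    (hbm : Measurable (Function.uncurry b)) (hg : Integrable g μ)
    (hbg : ∀ a τ, ‖b a τ‖ ≤ g a) (hb : ∀ a, IsMultiplier η s x₀ l (b a) (c a)) :
    IsMultiplier η s x₀ l (fun τ ↦ ∫ a, b a τ ∂μ) (∫ a, c a ∂μ) := by
  have hm : Measurable fun τ ↦ ∫ a, b a τ ∂μ := by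
    have h1 : StronglyMeasurable (Function.uncurry fun (τ : ℝ) (a : α) ↦ b a τ) :=
      (hbm.comp measurable_swap).stronglyMeasurable
    exact h1.integral_prod_right.measurable
  have hbd : ∀ τ, ‖∫ a, b a τ ∂μ‖ ≤ ∫ a, g a ∂μ := fun τ ↦
    norm_integral_le_of_norm_le hg (Filter.Eventually.of_forall fun a ↦ hbg a τ)
  have key : ∀ h : V → ℂ, Integrable h → ∀ x,
      𝓕⁻ (fun ξ ↦ (∫ a, b a ⟪ξ, η⟫ ∂μ) * h ξ) x =
        ∫ a, 𝓕⁻ (fun ξ ↦ b a ⟪ξ, η⟫ * h ξ) x ∂μ := fun h hh x ↦ by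
    simp only [fourierInv_eq_integral_exp]
    rw [integral_integral_swap]
    · congr 1; ext ξ
      rw [← integral_mul_const, ← integral_const_mul]
    · have h0 : Integrable (fun p : α × V ↦ g p.1 * ‖h p.2‖) (μ.prod volume) := hg.mul_prod hh.norm
      refine h0.mono' ?_ (Filter.Eventually.of_forall fun p ↦ ?_)
      · refine AEStronglyMeasurable.mul ?_ (AEStronglyMeasurable.mul ?_ ?_)
        · exact (by fun_prop : Measurable _).aestronglyMeasurable
        · exact (hbm.comp (by fun_prop : Measurable fun p : α × V ↦
            (p.1, (⟪p.2, η⟫ : ℝ)))).aestronglyMeasurable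
        · exact hh.aestronglyMeasurable.comp_snd
      · simp only [Function.uncurry, norm_mul, norm_exp_two_pi_I, one_mul]
        gcongr
        exact hbg _ _
  refine ⟨hm, ⟨_, hbd⟩, fun h hh ↦ ⟨integrable_comp_inner_mul hm hbd hh.integrable η,
    fun x hx ↦ ?_⟩, fun h hh ↦ ?_⟩
  · rw [key h hh.integrable]
    simp only [((hb _).map h hh).vanish x hx, integral_zero]
  · have e1 : lineLaplace η x₀ l (fun ξ ↦ (∫ a, b a ⟪ξ, η⟫ ∂μ) * h ξ) =
        ∫ a, lineLaplace η x₀ l (fun ξ ↦ b a ⟪ξ, η⟫ * h ξ) ∂μ := by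
      simp only [lineLaplace, key h hh.integrable]
      rw [integral_integral_swap]
      · congr 1; ext u
        rw [← integral_const_mul]
      · have h0 : Integrable (fun p : α × ℝ ↦
            (g p.1 * ∫ ξ, ‖h ξ‖) * envelope l.re (s - ⟪x₀, η⟫) p.2) (μ.prod volume) :=
          (hg.mul_const _).mul_prod (integrable_envelope hl _)
        refine h0.mono' ?_ (Filter.Eventually.of_forall fun p ↦ ?_)
        · refine AEStronglyMeasurable.mul ?_ ?_
          · exact (by fun_prop : Measurable _).aestronglyMeasurable
          · have h2 : AEStronglyMeasurable (fun q : (α × ℝ) × V ↦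
                Complex.exp (2 * Real.pi * Complex.I * (⟪q.2, x₀ + q.1.2 • η⟫ : ℝ)) *
                  (b q.1.1 ⟪q.2, η⟫ * h q.2)) ((μ.prod volume).prod volume) := by
              refine AEStronglyMeasurable.mul ?_ (AEStronglyMeasurable.mul ?_ ?_)
              · exact (by fun_prop : Measurable _).aestronglyMeasurable
              · exact (hbm.comp (by fun_prop : Measurable fun q : (α × ℝ) × V ↦
                  (q.1.1, (⟪q.2, η⟫ : ℝ)))).aestronglyMeasurable
              · exact hh.integrable.aestronglyMeasurable.comp_snd
            have h3 := h2.integral_prod_right'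
            simpa only [Function.uncurry, fourierInv_eq_integral_exp] using h3
        · refine (((hb p.1).map h hh).norm_le_envelope hη x₀ l p.2).trans ?_
          rw [mul_comm]
          refine mul_le_mul_of_nonneg_right ?_ (indicator_nonneg (fun _ _ ↦ (Real.exp_pos _).le) _)
          rw [← integral_const_mul]
          refine integral_mono_of_nonneg (Filter.Eventually.of_forall fun _ ↦ norm_nonneg _)
            (hh.integrable.norm.const_mul _) (Filter.Eventually.of_forall fun ξ ↦ ?_)
          simp only [norm_mul]
          exact mul_le_mul_of_nonneg_right (hbg _ _) (norm_nonneg _)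
    rw [e1, ← integral_mul_const]
    congr 1; ext a
    exact (hb a).laplace h hh

/-- The exponential series is an integral over ℕ with counting measure, so it is a superposition of
powers of `b`. -/
theorem exp (hη : ‖η‖ = 1) (hl : 0 < l.re) {b : ℝ → ℂ} {c : ℂ}
    (hb : IsMultiplier η s x₀ l b c) :
    IsMultiplier η s x₀ l (fun τ ↦ Complex.exp (b τ)) (Complex.exp c) := by
  obtain ⟨C, hC⟩ := hb.bounded
  have hC0 : 0 ≤ C := (norm_nonneg _).trans (hC 0)
  have e : ∀ z : ℂ, Complex.exp z =
      ∫ n : ℕ, ((n.factorial : ℂ)⁻¹ * z ^ n) ∂Measure.count := fun z ↦ by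
    have hs := NormedSpace.expSeries_div_hasSum_exp z
    rw [← Complex.exp_eq_exp_ℂ] at hs
    rw [integral_countable (integrable_count_iff.2 ?_)]
    · simp only [Measure.real, Measure.count_singleton, ENNReal.toReal_one, one_smul]
      rw [← hs.tsum_eq]
      congr 1; ext n; rw [div_eq_inv_mul]
    · simpa only [div_eq_inv_mul] using (NormedSpace.expSeries_div_summable z).norm
  simp only [e]
  refine IsMultiplier.integral hη hl (g := fun n ↦ (n.factorial : ℝ)⁻¹ * C ^ n) ?_ ?_ ?_ ?_
  · refine measurable_from_prod_countable_right fun n ↦ ?_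
    exact (hb.measurable.pow_const n).const_mul (n.factorial : ℂ)⁻¹
  · rw [integrable_count_iff]
    simpa only [div_eq_inv_mul] using (Real.summable_pow_div_factorial C).norm
  · intro n τ
    rw [norm_mul, norm_pow, norm_inv, Complex.norm_natCast]
    gcongr
    exact hC τ
  · exact fun n ↦ (const _).mul (hb.pow n)

end IsMultiplier

end Multipliers

/-! ### Poisson kernel, outer functions and the Jensen inequality for continuous weights. -/

section Poisson

variable {V : Type*} [NormedAddCommGroup V] [InnerProductSpace ℝ V] [FiniteDimensional ℝ V]
  [MeasurableSpace V] [BorelSpace V]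

/-- The Poisson kernel of the upper half-plane. -/
def poisson (y t : ℝ) : ℝ := y / (Real.pi * (y ^ 2 + t ^ 2))

theorem poisson_nonneg {y : ℝ} (hy : 0 ≤ y) (t : ℝ) : 0 ≤ poisson y t := by
  unfold poisson; positivity

theorem poisson_le {y : ℝ} (hy : 0 < y) (t : ℝ) : poisson y t ≤ 1 / (Real.pi * y) := by
  unfold poisson
  rw [div_le_div_iff₀ (by positivity) (by positivity)]
  nlinarith [Real.pi_pos, mul_nonneg Real.pi_pos.le (sq_nonneg t)]

@[fun_prop]
theorem measurable_poisson : Measurable fun p : ℝ × ℝ ↦ poisson p.1 p.2 := by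
  unfold poisson; fun_prop

theorem continuousOn_poisson (t : ℝ) : ContinuousOn (fun y ↦ poisson y t) (Ioi 0) := by
  unfold poisson
  refine ContinuousOn.div (by fun_prop) (by fun_prop) fun y hy ↦ ?_
  have : 0 < y := hy
  positivity

theorem integral_poisson_one : ∫ t, poisson 1 t = 1 := by
  have : ∀ t : ℝ, poisson 1 t = Real.pi⁻¹ * (1 + t ^ 2)⁻¹ := fun t ↦ by
    unfold poisson; rw [one_pow, one_div, mul_inv]
  simp_rw [this]
  rw [integral_const_mul, integral_univ_inv_one_add_sq, inv_mul_cancel₀ Real.pi_ne_zero]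

theorem integrable_poisson_one : Integrable (poisson 1) := by
  have : poisson 1 = fun t : ℝ ↦ Real.pi⁻¹ * (1 + t ^ 2)⁻¹ := by
    ext t; unfold poisson; rw [one_pow, one_div, mul_inv]
  rw [this]
  exact integrable_inv_one_add_sq.const_mul _

theorem integral_mul_poisson_sub (φ : ℝ → ℝ) {y : ℝ} (hy : 0 < y) (τ : ℝ) :
    ∫ t, φ t * poisson y (τ - t) = ∫ r, φ (τ - y * r) * poisson 1 r := by
  rw [← integral_sub_left_eq_self _ volume τ]
  have := Measure.integral_comp_mul_left (fun r ↦ φ (τ - r) * poisson y (τ - (τ - r))) y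
  rw [abs_of_pos (inv_pos.2 hy), smul_eq_mul, inv_mul_eq_div, eq_div_iff hy.ne'] at this
  rw [← this, ← integral_mul_const]
  congr 1; ext r
  rw [sub_sub_cancel, mul_assoc]
  congr 1
  unfold poisson
  field_simp

/-- After rescaling, the kernel is the fixed probability density `poisson 1` and the height sits
inside `φ`, so dominated convergence applies. -/
theorem tendsto_integral_mul_poisson {φ : ℝ → ℝ} (hφ : Continuous φ) {B : ℝ}
    (hB : ∀ t, |φ t| ≤ B) (τ : ℝ) {y : ℕ → ℝ} (hy : ∀ n, 0 < y n)
    (hy0 : Filter.Tendsto y Filter.atTop (nhds 0)) :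
    Filter.Tendsto (fun n ↦ ∫ t, φ t * poisson (y n) (τ - t)) Filter.atTop (nhds (φ τ)) := by
  simp_rw [fun n ↦ integral_mul_poisson_sub φ (hy n) τ]
  have h1 : φ τ = ∫ r, φ τ * poisson 1 r := by
    rw [integral_const_mul, integral_poisson_one, mul_one]
  rw [h1]
  refine tendsto_integral_of_dominated_convergence (fun r ↦ B * poisson 1 r)
    (fun n ↦ ?_) (integrable_poisson_one.const_mul B) (fun n ↦ ?_) ?_
  · exact (by fun_prop : Measurable _).aestronglyMeasurable
  · refine Filter.Eventually.of_forall fun r ↦ ?_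
    rw [norm_mul, Real.norm_eq_abs, Real.norm_eq_abs, abs_of_nonneg (poisson_nonneg zero_le_one r)]
    exact mul_le_mul_of_nonneg_right (hB _) (poisson_nonneg zero_le_one r)
  · refine Filter.Eventually.of_forall fun r ↦ Filter.Tendsto.mul_const _ ?_
    have : Filter.Tendsto (fun n ↦ τ - y n * r) Filter.atTop (nhds (τ - 0 * r)) :=
      (hy0.mul_const r).const_sub τ
    rw [zero_mul, sub_zero] at this
    exact (hφ.tendsto τ).comp this

theorem integral_mul_poisson_le {φ : ℝ → ℝ} {B : ℝ}
    (hB : ∀ t, |φ t| ≤ B) (τ : ℝ) {y : ℝ} (hy : 0 < y) :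
    ∫ t, φ t * poisson y (τ - t) ≤ B := by
  rw [integral_mul_poisson_sub φ hy]
  have h1 : B = ∫ r, B * poisson 1 r := by
    rw [integral_const_mul, integral_poisson_one, mul_one]
  rw [h1]
  refine (Real.le_norm_self _).trans (norm_integral_le_of_norm_le (integrable_poisson_one.const_mul B) ?_)
  refine Filter.Eventually.of_forall fun r ↦ ?_
  rw [norm_mul, Real.norm_eq_abs, Real.norm_eq_abs, abs_of_nonneg (poisson_nonneg zero_le_one r)]
  exact mul_le_mul_of_nonneg_right (hB _) (poisson_nonneg zero_le_one r)

/-- The analytic completion of the Poisson kernel. -/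
def herglotz (z : ℂ) : ℂ := 1 / (Real.pi * z)

@[fun_prop]
theorem measurable_herglotz : Measurable herglotz := by unfold herglotz; fun_prop

theorem re_herglotz (y t : ℝ) : (herglotz (y + Complex.I * t)).re = poisson y t := by
  unfold herglotz poisson
  have : (1 : ℂ) / (Real.pi * (y + Complex.I * t)) =
      ((Real.pi⁻¹ : ℝ) : ℂ) * (y + Complex.I * t)⁻¹ := by
    rw [one_div, mul_inv]; push_cast; rfl
  rw [this, Complex.re_ofReal_mul, Complex.inv_re]
  simp only [Complex.normSq_apply, Complex.add_re, Complex.ofReal_re, Complex.mul_re, Complex.I_re,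
    Complex.ofReal_im, Complex.I_im, Complex.add_im, Complex.mul_im]
  rw [inv_mul_eq_div, div_div]; ring_nf

theorem norm_herglotz_le {z : ℂ} {y : ℝ} (hy : 0 < y) (hz : y ≤ z.re) :
    ‖herglotz z‖ ≤ 1 / (Real.pi * y) := by
  unfold herglotz
  rw [norm_div, norm_one, norm_mul, Complex.norm_real, Real.norm_of_nonneg Real.pi_pos.le]
  gcongr
  exact hz.trans (Complex.re_le_norm z)

/-- Only frequencies `v > 0` occur, which makes the kernel a superposition of admissible characters.
-/
theorem integral_exp_eq_herglotz {z : ℂ} (hz : 0 < z.re) :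
    ∫ v : ℝ in Ioi 0, 2 * Complex.exp (-(2 * Real.pi * z) * v) = herglotz z := by
  rw [integral_const_mul, integral_exp_mul_complex_Ioi]
  · unfold herglotz
    have : z ≠ 0 := by rintro rfl; simp at hz
    simp; field_simp
  · have : -(2 * Real.pi * z) = ((-(2 * Real.pi) : ℝ) : ℂ) * z := by push_cast; ring
    rw [this, Complex.re_ofReal_mul]
    nlinarith [Real.pi_pos]

variable {η x₀ : V} {s : ℝ} {l : ℂ}

theorem isMultiplier_herglotz (hη : ‖η‖ = 1) (hl : 0 < l.re) {y : ℝ} (hy : 0 < y) (t : ℝ) :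
    IsMultiplier η s x₀ l (fun τ ↦ herglotz (y - Complex.I * (τ - t)))
      (herglotz (y + l + Complex.I * t)) := by
  have hre : ∀ τ : ℝ, (y - Complex.I * (τ - t) : ℂ).re = y := fun τ ↦ by simp
  have key : IsMultiplier η s x₀ l
      -- `|v|` replaces `v` because `IsMultiplier.integral` requires a multiplier for every real
      -- `v`, not only for those in `Ioi 0`.
      (fun τ ↦ ∫ v : ℝ in Ioi 0, 2 * Complex.exp (-(2 * Real.pi * (y + Complex.I * t)) * v) *
        Complex.exp (2 * Real.pi * Complex.I * ((|v| : ℝ) * τ)))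
      (∫ v : ℝ in Ioi 0, 2 * Complex.exp (-(2 * Real.pi * (y + Complex.I * t)) * v) *
        Complex.exp (-(2 * Real.pi * l * (|v| : ℝ)))) := by
    refine IsMultiplier.integral hη hl (g := fun v ↦ 2 * Real.exp (-(2 * Real.pi * y) * v))
      ?_ ?_ ?_ ?_
    · unfold Function.uncurry; fun_prop
    · exact (integrableOn_exp_mul_Ioi (by nlinarith [mul_pos Real.pi_pos hy]) 0).const_mul 2
    · intro v τ
      have := norm_exp_two_pi_I (|v| * τ); push_cast at this
      rw [norm_mul, norm_mul, this, Complex.norm_exp]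
      have e : (-(2 * Real.pi * (y + Complex.I * t)) * v : ℂ).re = -(2 * Real.pi * y) * v := by
        simp
      rw [e]; simp
    · intro v
      exact (IsMultiplier.const _).mul (IsMultiplier.char hη (abs_nonneg v))
  convert key using 1
  · ext τ
    rw [← integral_exp_eq_herglotz (by rw [hre]; exact hy)]
    refine setIntegral_congr_fun measurableSet_Ioi fun v hv ↦ ?_
    have hv0 : 0 < v := hv
    rw [abs_of_pos hv0, mul_assoc (2 : ℂ) (Complex.exp _), ← Complex.exp_add]
    congr 2; ring
  · rw [← integral_exp_eq_herglotz (by simp; positivity)]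
    refine setIntegral_congr_fun measurableSet_Ioi fun v hv ↦ ?_
    have hv0 : 0 < v := hv
    rw [abs_of_pos hv0, mul_assoc (2 : ℂ) (Complex.exp _), ← Complex.exp_add]
    congr 2; ring

theorem integrable_mul_herglotz {φ : ℝ → ℝ} (hφ : Integrable φ) {z : ℝ → ℂ} (hz : Measurable z)
    {y : ℝ} (hy : 0 < y) (hzy : ∀ t, y ≤ (z t).re) :
    Integrable fun t ↦ (φ t : ℂ) * herglotz (z t) :=
  hφ.ofReal.mul_bdd (c := 1 / (Real.pi * y)) (measurable_herglotz.comp hz).aestronglyMeasurable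
    (Filter.Eventually.of_forall fun t ↦ norm_herglotz_le hy (hzy t))

/-- The Jensen type inequality for the outer function with boundary modulus `exp φ`, at height `y`
over the boundary. -/
theorem HalfSpectrum.norm_lineLaplace_mul_exp_le {h : V → ℂ} (hh : HalfSpectrum η s h)
    (hη : ‖η‖ = 1) (hl : 0 < l.re) {φ : ℝ → ℝ} (hφm : Measurable φ) (hφ : Integrable φ)
    {y : ℝ} (hy : 0 < y) :
    ‖lineLaplace η x₀ l h‖ * Real.exp (∫ t, φ t * poisson (y + l.re) (t + l.im)) ≤
      (∫ u, envelope l.re (s - ⟪x₀, η⟫) u) *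
        ∫ ξ, ‖h ξ‖ * Real.exp (∫ t, φ t * poisson y (⟪ξ, η⟫ - t)) := by
  have hre : ∀ τ t : ℝ, (y - Complex.I * (τ - t) : ℂ).re = y := fun τ t ↦ by simp
  have hre' : ∀ t : ℝ, (y + l + Complex.I * t : ℂ).re = y + l.re := fun t ↦ by simp
  -- Height `y > 0` keeps the kernel bounded by 1 / (πy), so integrability of `φ` suffices. The
  -- multiplier's value is its formula at τ = il, where y - i(il - t) = y + l + it.
  have key : IsMultiplier η s x₀ l
      (fun τ ↦ ∫ t, (φ t : ℂ) * herglotz (y - Complex.I * (τ - t)))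
      (∫ t, (φ t : ℂ) * herglotz (y + l + Complex.I * t)) := by
    refine IsMultiplier.integral hη hl (g := fun t ↦ |φ t| * (1 / (Real.pi * y))) ?_
      (hφ.abs.mul_const _) (fun t τ ↦ ?_)
      fun t ↦ (IsMultiplier.const _).mul (isMultiplier_herglotz hη hl hy t)
    · unfold Function.uncurry; fun_prop
    · rw [norm_mul, Complex.norm_real, Real.norm_eq_abs]
      gcongr
      exact norm_herglotz_le hy (hre τ t).ge
  have hE := key.exp hη hl
  have h1 := (hE.map h hh).norm_lineLaplace_le hη x₀ hl
  rw [hE.laplace h hh, norm_mul, Complex.norm_exp, mul_comm] at h1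
  have r1 : (∫ t, (φ t : ℂ) * herglotz (y + l + Complex.I * t)).re =
      ∫ t, φ t * poisson (y + l.re) (t + l.im) := by
    rw [← RCLike.re_to_complex, ← integral_re]
    · congr 1; ext t
      rw [RCLike.re_to_complex, Complex.re_ofReal_mul, ← re_herglotz]
      congr 3
      apply Complex.ext <;> simp [add_comm]
    · exact integrable_mul_herglotz hφ (by fun_prop) (by positivity : 0 < y + l.re)
        fun t ↦ (hre' t).ge
  have r2 : ∀ τ : ℝ, (∫ t, (φ t : ℂ) * herglotz (y - Complex.I * (τ - t))).re =
      ∫ t, φ t * poisson y (τ - t) := fun τ ↦ by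
    rw [← RCLike.re_to_complex, ← integral_re]
    · congr 1; ext t
      rw [RCLike.re_to_complex, Complex.re_ofReal_mul]
      have : (y - Complex.I * (τ - t) : ℂ) = y + Complex.I * ((-(τ - t) : ℝ) : ℂ) := by
        push_cast; ring
      rw [this, re_herglotz]
      unfold poisson; rw [neg_sq]
    · exact integrable_mul_herglotz hφ (by fun_prop) hy fun t ↦ (hre τ t).ge
  rw [r1] at h1
  refine h1.trans_eq ?_
  congr 2; ext ξ
  rw [norm_mul, Complex.norm_exp, r2, mul_comm]

theorem tendsto_exp_mul_integral {g : ℕ → V → ℝ} {g' : V → ℝ} {h : V → ℂ} (hh : Integrable h)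
    (hg : ∀ n, AEStronglyMeasurable (g n) volume) {B : ℝ} (hB : ∀ n ξ, g n ξ ≤ B)
    (hlim : ∀ᵐ ξ, Filter.Tendsto (fun n ↦ g n ξ) Filter.atTop (nhds (g' ξ))) :
    Filter.Tendsto (fun n ↦ ∫ ξ, ‖h ξ‖ * Real.exp (g n ξ)) Filter.atTop
      (nhds (∫ ξ, ‖h ξ‖ * Real.exp (g' ξ))) := by
  refine tendsto_integral_of_dominated_convergence (fun ξ ↦ ‖h ξ‖ * Real.exp B)
    (fun n ↦ ?_) (hh.norm.mul_const _) (fun n ↦ ?_) ?_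
  · exact hh.norm.aestronglyMeasurable.mul (Real.continuous_exp.comp_aestronglyMeasurable (hg n))
  · refine Filter.Eventually.of_forall fun ξ ↦ ?_
    rw [norm_mul, norm_norm, Real.norm_eq_abs, Real.abs_exp]
    gcongr
    exact hB n ξ
  · filter_upwards [hlim] with ξ hξ
    exact ((Real.continuous_exp.tendsto _).comp hξ).const_mul _

/-- Let the height y tend to 0. On the left the kernel at height y + Re l stays bounded; on the
right the Poisson averages converge at every point because `φ` is continuous. -/
theorem HalfSpectrum.norm_lineLaplace_mul_exp_le_of_continuous {h : V → ℂ}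
    (hh : HalfSpectrum η s h) (hη : ‖η‖ = 1) (hl : 0 < l.re) {φ : ℝ → ℝ} (hφc : Continuous φ)
    (hφ : Integrable φ) {B : ℝ} (hB : ∀ t, |φ t| ≤ B) :
    ‖lineLaplace η x₀ l h‖ * Real.exp (∫ t, φ t * poisson l.re (t + l.im)) ≤
      (∫ u, envelope l.re (s - ⟪x₀, η⟫) u) * ∫ ξ, ‖h ξ‖ * Real.exp (φ ⟪ξ, η⟫) := by
  set y : ℕ → ℝ := fun n ↦ 1 / ((n : ℝ) + 1)
  have hy : ∀ n, 0 < y n := fun n ↦ by positivity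
  have hy0 : Filter.Tendsto y Filter.atTop (nhds 0) := tendsto_one_div_add_atTop_nhds_zero_nat
  refine le_of_tendsto_of_tendsto' (b := Filter.atTop) ?_ ?_
    fun n ↦ hh.norm_lineLaplace_mul_exp_le (x₀ := x₀) hη hl hφc.measurable hφ (hy n)
  · refine ((Real.continuous_exp.tendsto _).comp ?_).const_mul _
    refine tendsto_integral_of_dominated_convergence (fun t ↦ |φ t| * (1 / (Real.pi * l.re)))
      (fun n ↦ ?_) (hφ.abs.mul_const _) (fun n ↦ ?_) ?_
    · exact (by fun_prop : Measurable _).aestronglyMeasurable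
    · refine Filter.Eventually.of_forall fun t ↦ ?_
      have hp : 0 < y n + l.re := add_pos (hy n) hl
      rw [norm_mul, Real.norm_eq_abs, Real.norm_eq_abs, abs_of_nonneg (poisson_nonneg hp.le _)]
      refine mul_le_mul_of_nonneg_left ((poisson_le hp _).trans ?_) (abs_nonneg _)
      have := (hy n).le
      gcongr
      linarith
    · refine Filter.Eventually.of_forall fun t ↦ Filter.Tendsto.const_mul _ ?_
      have h1 : ContinuousAt (fun y ↦ poisson y (t + l.im)) l.re :=
        (continuousOn_poisson _).continuousAt (Ioi_mem_nhds hl)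
      refine h1.tendsto.comp ?_
      simpa using hy0.add_const l.re
  · refine (tendsto_exp_mul_integral (B := B)
      (g := fun n ξ ↦ ∫ t, φ t * poisson (y n) (⟪ξ, η⟫ - t)) (g' := fun ξ ↦ φ ⟪ξ, η⟫)
      hh.integrable (fun n ↦ ?_)
      (fun n ξ ↦ integral_mul_poisson_le hB ⟪ξ, η⟫ (hy n))
      (Filter.Eventually.of_forall fun ξ ↦ tendsto_integral_mul_poisson hφc hB ⟪ξ, η⟫ hy hy0)).const_mul _
    have h1 : Measurable fun τ ↦ ∫ t, φ t * poisson (y n) (τ - t) := by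
      have h2 : StronglyMeasurable (Function.uncurry fun (τ t : ℝ) ↦ φ t * poisson (y n) (τ - t)) := by
        refine Measurable.stronglyMeasurable ?_
        unfold Function.uncurry; fun_prop
      exact h2.integral_prod_right.measurable
    exact (h1.comp (by fun_prop : Measurable fun ξ : V ↦ (⟪ξ, η⟫ : ℝ))).aestronglyMeasurable

end Poisson

/-! ### Bounded measurable weights and the divergent logarithmic integral. -/

section LogIntegral

variable {V : Type*} [NormedAddCommGroup V] [InnerProductSpace ℝ V] [FiniteDimensional ℝ V]
  [MeasurableSpace V] [BorelSpace V]

variable {η x₀ : V} {s : ℝ} {l : ℂ}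

theorem integrable_poisson {y : ℝ} (hy : 0 < y) : Integrable (poisson y) := by
  have : poisson y = fun t ↦ y⁻¹ * poisson 1 (t / y) := by
    ext t; unfold poisson; field_simp
  rw [this]
  exact (integrable_poisson_one.comp_div hy.ne').const_mul _

/-- Needed to pull statements that hold for almost every real number back to almost every `ξ`. -/
theorem quasiMeasurePreserving_inner (hη : ‖η‖ = 1) :
    Measure.QuasiMeasurePreserving (fun ξ : V ↦ (⟪ξ, η⟫ : ℝ)) volume volume := by
  refine ⟨by fun_prop, ?_⟩
  have hsurj : Function.Surjective (innerₗ V η) := fun t ↦ ⟨t • η, by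
    simp [hη]⟩
  obtain ⟨c, -, hc⟩ := (innerₗ V η).exists_map_addHaar_eq_smul_addHaar volume volume hsurj
  have e : (fun ξ : V ↦ (⟪ξ, η⟫ : ℝ)) = innerₗ V η := by
    ext ξ; simp [real_inner_comm]
  rw [e, hc]
  exact Measure.smul_absolutelyContinuous

/-- The Jensen type inequality for the outer function with boundary modulus `exp φ`. -/
theorem HalfSpectrum.norm_lineLaplace_mul_exp_le_of_bounded {h : V → ℂ}
    (hh : HalfSpectrum η s h) (hη : ‖η‖ = 1) (hl : 0 < l.re) {φ : ℝ → ℝ}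
    (hφ : Integrable φ) {B : ℝ} (hB : ∀ t, |φ t| ≤ B) :
    ‖lineLaplace η x₀ l h‖ * Real.exp (∫ t, φ t * poisson l.re (t + l.im)) ≤
      (∫ u, envelope l.re (s - ⟪x₀, η⟫) u) * ∫ ξ, ‖h ξ‖ * Real.exp (φ ⟪ξ, η⟫) := by
  -- Mollification: the ratio of outer to inner radius is always 2, as the almost everywhere
  -- convergence theorem requires a bounded ratio.
  let χ : ℕ → ContDiffBump (0 : ℝ) := fun n ↦
    ⟨1 / (n + 1) / 2, 1 / (n + 1), by positivity, half_lt_self (by positivity)⟩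
  set g : ℕ → ℝ → ℝ := fun n ↦
    convolution ((χ n).normed volume) φ (ContinuousLinearMap.lsmul ℝ ℝ) volume
  have hlim : ∀ᵐ t, Filter.Tendsto (fun n ↦ g n t) Filter.atTop (nhds (φ t)) := by
    refine ContDiffBump.ae_convolution_tendsto_right_of_locallyIntegrable (K := 2) ?_ ?_
      hφ.locallyIntegrable
    · exact tendsto_one_div_add_atTop_nhds_zero_nat
    · exact Filter.Eventually.of_forall fun n ↦ by simp only [χ]; linarith
  have hgc : ∀ n, Continuous (g n) := fun n ↦
    (χ n).hasCompactSupport_normed.continuous_convolution_left _ (χ n).continuous_normed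
      hφ.locallyIntegrable
  have hgi : ∀ n, Integrable (g n) := fun n ↦
    (χ n).integrable_normed.integrable_convolution _ hφ
  have hgB : ∀ n t, |g n t| ≤ B := fun n t ↦ by
    have h1 : B = ∫ r, (χ n).normed volume r * B := by
      rw [integral_mul_const, (χ n).integral_normed, one_mul]
    rw [h1, ← Real.norm_eq_abs]
    refine norm_integral_le_of_norm_le ((χ n).integrable_normed.mul_const B)
      (Filter.Eventually.of_forall fun r ↦ ?_)
    rw [ContinuousLinearMap.lsmul_apply, norm_smul,
      Real.norm_of_nonneg ((χ n).nonneg_normed r)]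
    exact mul_le_mul_of_nonneg_left (hB _) ((χ n).nonneg_normed r)
  refine le_of_tendsto_of_tendsto' (b := Filter.atTop) ?_ ?_
    fun n ↦ hh.norm_lineLaplace_mul_exp_le_of_continuous (x₀ := x₀) hη hl (hgc n) (hgi n) (hgB n)
  · refine ((Real.continuous_exp.tendsto _).comp ?_).const_mul _
    have hp : Integrable fun t ↦ B * poisson l.re (t + l.im) :=
      ((integrable_poisson hl).comp_add_right _).const_mul _
    refine tendsto_integral_of_dominated_convergence _ (fun n ↦ ?_) hp (fun n ↦ ?_) ?_
    · have := (hgc n).measurable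
      exact (by fun_prop : Measurable _).aestronglyMeasurable
    · refine Filter.Eventually.of_forall fun t ↦ ?_
      rw [norm_mul, Real.norm_eq_abs, Real.norm_eq_abs, abs_of_nonneg (poisson_nonneg hl.le _)]
      exact mul_le_mul_of_nonneg_right (hgB _ _) (poisson_nonneg hl.le _)
    · filter_upwards [hlim] with t ht
      exact ht.mul_const _
  · refine (tendsto_exp_mul_integral (B := B) (g := fun n ξ ↦ g n ⟪ξ, η⟫)
      (g' := fun ξ ↦ φ ⟪ξ, η⟫) hh.integrable (fun n ↦ ?_)
      (fun n ξ ↦ (le_abs_self _).trans (hgB n _)) ?_).const_mul _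
    · exact ((hgc n).comp (by fun_prop)).aestronglyMeasurable
    · exact (quasiMeasurePreserving_inner hη).ae hlim

/-- For t > 1 the shifted Poisson kernel is at least a positive constant times 1 / t². -/
theorem lintegral_poisson_eq_top {ψ : ℝ → ℝ} (hψ0 : ∀ t, 0 ≤ ψ t)
    (hI : logIntegral ψ = ∞) {y : ℝ} (hy : 0 < y) (σ : ℝ) :
    ∫⁻ t, ENNReal.ofReal (ψ |t| * poisson y (t + σ)) = ∞ := by
  -- Comes from |t + σ| ≤ (1 + |σ|) t and y² ≤ y² t² for t > 1.
  set D : ℝ := Real.pi * (y ^ 2 + (1 + |σ|) ^ 2) / y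
  have hD : 0 < D := by positivity
  have hle : logIntegral ψ ≤
      ENNReal.ofReal D * ∫⁻ t, ENNReal.ofReal (ψ |t| * poisson y (t + σ)) := by
    rw [← lintegral_const_mul' _ _ ENNReal.ofReal_ne_top, logIntegral]
    refine (setLIntegral_mono' measurableSet_Ioi fun t ht ↦ ?_).trans (setLIntegral_le_lintegral _ _)
    have ht1 : 1 < t := ht
    have ht0 : 0 < t := by linarith
    rw [← ENNReal.ofReal_mul hD.le, abs_of_pos ht0]
    refine ENNReal.ofReal_le_ofReal ?_
    have h1 : 1 / t ^ 2 ≤ D * poisson y (t + σ) := by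
      have e : D * poisson y (t + σ) = (y ^ 2 + (1 + |σ|) ^ 2) / (y ^ 2 + (t + σ) ^ 2) := by
        simp only [D, poisson]; field_simp
      rw [e, div_le_div_iff₀ (by positivity) (by positivity), one_mul]
      have h2 : |t + σ| ≤ (1 + |σ|) * t := by
        refine (abs_add_le _ _).trans ?_
        rw [abs_of_pos ht0]
        nlinarith [abs_nonneg σ]
      have h3 : (t + σ) ^ 2 ≤ ((1 + |σ|) * t) ^ 2 := by
        rw [← sq_abs (t + σ)]; gcongr
      have h4 : y ^ 2 ≤ y ^ 2 * t ^ 2 := le_mul_of_one_le_right (by positivity) (by nlinarith)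
      nlinarith
    calc ψ t / t ^ 2 = ψ t * (1 / t ^ 2) := by ring
      _ ≤ ψ t * (D * poisson y (t + σ)) := mul_le_mul_of_nonneg_left h1 (hψ0 t)
      _ = D * (ψ t * poisson y (t + σ)) := by ring
  by_contra hne
  rw [hI] at hle
  exact (ENNReal.mul_lt_top ENNReal.ofReal_lt_top (lt_top_iff_ne_top.2 hne)).not_ge hle

/-- If the Laplace transform were nonzero, the Jensen inequality would bound the Poisson integrals
of all truncations of the weight, and Fatou would make the full Poisson integral finite. -/
theorem HalfSpectrum.lineLaplace_eq_zero {h : V → ℂ} (hh : HalfSpectrum η s h)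
    (hη : ‖η‖ = 1) (hl : 0 < l.re) {ψ : ℝ → ℝ} (hψm : Measurable ψ) (hψ0 : ∀ t, 0 ≤ ψ t)
    (hint : Integrable fun ξ ↦ ‖h ξ‖ * Real.exp (ψ |⟪ξ, η⟫|)) (hI : logIntegral ψ = ∞) :
    lineLaplace η x₀ l h = 0 := by
  by_contra hne
  have hJ : 0 < ‖lineLaplace η x₀ l h‖ := norm_pos_iff.2 hne
  set K := ∫ u, envelope l.re (s - ⟪x₀, η⟫) u
  have hK : 0 ≤ K := integral_nonneg fun u ↦ indicator_nonneg (fun _ _ ↦ (Real.exp_pos _).le) u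
  set M := ∫ ξ, ‖h ξ‖ * Real.exp (ψ |⟪ξ, η⟫|)
  -- Truncation in both range and domain makes the weight bounded and integrable.
  set φ : ℕ → ℝ → ℝ := fun n ↦ (Icc (-(n : ℝ)) n).indicator fun t ↦ min (ψ |t|) n
  have hφ0 : ∀ n t, 0 ≤ φ n t := fun n t ↦
    indicator_nonneg (fun _ _ ↦ le_min (hψ0 _) n.cast_nonneg) t
  have hφn : ∀ n t, |φ n t| ≤ n := fun n t ↦ by
    rw [abs_of_nonneg (hφ0 n t)]
    exact indicator_le' (fun _ _ ↦ min_le_right _ _) (fun _ _ ↦ n.cast_nonneg) t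
  have hφψ : ∀ n t, φ n t ≤ ψ |t| := fun n t ↦
    indicator_le' (fun _ _ ↦ min_le_left _ _) (fun _ _ ↦ hψ0 _) t
  have hφm : ∀ n, Measurable (φ n) := fun n ↦
    Measurable.indicator (by fun_prop) measurableSet_Icc
  have hφi : ∀ n, Integrable (φ n) := fun n ↦ by
    refine (integrable_indicator_iff measurableSet_Icc).2 ?_
    refine Measure.integrableOn_of_bounded (M := n) (by simp)
      (by fun_prop : Measurable _).aestronglyMeasurable (Filter.Eventually.of_forall fun t ↦ ?_)
    rw [Real.norm_eq_abs, abs_of_nonneg (le_min (hψ0 _) n.cast_nonneg)]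
    exact min_le_right _ _
  have hbound : ∀ n, ∫ t, φ n t * poisson l.re (t + l.im) ≤
      K * M / ‖lineLaplace η x₀ l h‖ := fun n ↦ by
    have h1 := hh.norm_lineLaplace_mul_exp_le_of_bounded (x₀ := x₀) hη hl (hφi n) (hφn n)
    have h2 : ∫ ξ, ‖h ξ‖ * Real.exp (φ n ⟪ξ, η⟫) ≤ M := by
      refine integral_mono_of_nonneg (Filter.Eventually.of_forall fun ξ ↦ by positivity) hint
        (Filter.Eventually.of_forall fun ξ ↦ ?_)
      have := hφψ n ⟪ξ, η⟫
      beta_reduce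
      gcongr
    have h3 := h1.trans (mul_le_mul_of_nonneg_left h2 hK)
    rw [le_div_iff₀ hJ, mul_comm]
    refine le_trans (mul_le_mul_of_nonneg_left ?_ hJ.le) h3
    -- Uses x ≤ exp x, which avoids taking a logarithm.
    linarith [Real.add_one_le_exp (∫ t, φ n t * poisson l.re (t + l.im))]
  have hlin : ∀ n, ∫⁻ t, ENNReal.ofReal (φ n t * poisson l.re (t + l.im)) ≤
      ENNReal.ofReal (K * M / ‖lineLaplace η x₀ l h‖) := fun n ↦ by
    rw [← ofReal_integral_eq_lintegral_ofReal]
    · exact ENNReal.ofReal_le_ofReal (hbound n)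
    · refine (hφi n).mul_bdd (c := 1 / (Real.pi * l.re))
        (by fun_prop : Measurable _).aestronglyMeasurable (Filter.Eventually.of_forall fun t ↦ ?_)
      rw [Real.norm_of_nonneg (poisson_nonneg hl.le _)]
      exact poisson_le hl _
    · exact Filter.Eventually.of_forall fun t ↦ mul_nonneg (hφ0 n t) (poisson_nonneg hl.le _)
  have hpt : ∀ t, Filter.Tendsto
      (fun n ↦ ENNReal.ofReal (φ n t * poisson l.re (t + l.im))) Filter.atTop
      (nhds (ENNReal.ofReal (ψ |t| * poisson l.re (t + l.im)))) := fun t ↦ by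
    -- For fixed `t` the sequence is eventually constant.
    refine tendsto_const_nhds.congr' ?_
    filter_upwards [Filter.eventually_ge_atTop ⌈max |t| (ψ |t|)⌉₊] with n hn
    have h1 := (Nat.le_ceil _).trans (Nat.cast_le (α := ℝ).2 hn)
    have h2 : t ∈ Icc (-(n : ℝ)) n := abs_le.1 ((le_max_left _ _).trans h1)
    simp only [φ]
    rw [indicator_of_mem h2, min_eq_left ((le_max_right _ _).trans h1)]
  have hfatou : ∫⁻ t, ENNReal.ofReal (ψ |t| * poisson l.re (t + l.im)) ≤
      ENNReal.ofReal (K * M / ‖lineLaplace η x₀ l h‖) := by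
    calc _ = ∫⁻ t, Filter.liminf
          (fun n ↦ ENNReal.ofReal (φ n t * poisson l.re (t + l.im))) Filter.atTop := by
          congr 1; ext t; exact (hpt t).liminf_eq.symm
      _ ≤ Filter.liminf (fun n ↦
          ∫⁻ t, ENNReal.ofReal (φ n t * poisson l.re (t + l.im))) Filter.atTop :=
          lintegral_liminf_le fun n ↦ by have := hφm n; fun_prop
      _ ≤ _ := Filter.liminf_le_of_le (by isBoundedDefault) fun b hb ↦
          let ⟨n, hn⟩ := hb.exists; hn.trans (hlin n)
  rw [lintegral_poisson_eq_top hψ0 hI hl] at hfatou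
  exact ENNReal.ofReal_ne_top (top_le_iff.1 hfatou)

/-- A function with one-sided spectrum and divergent logarithmic integral vanishes. -/
theorem HalfSpectrum.fourierInv_eq_zero {h : V → ℂ} (hh : HalfSpectrum η s h)
    (hη : ‖η‖ = 1) {ψ : ℝ → ℝ} (hψm : Measurable ψ) (hψ0 : ∀ t, 0 ≤ ψ t)
    (hint : Integrable fun ξ ↦ ‖h ξ‖ * Real.exp (ψ |⟪ξ, η⟫|)) (hI : logIntegral ψ = ∞)
    (x : V) : 𝓕⁻ h x = 0 := by
  set g : ℝ → ℂ := fun u ↦ Complex.exp (2 * Real.pi * (1 : ℂ) * u) * 𝓕⁻ h (x + u • η)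
  have hgc : Continuous g := by
    have := continuous_fourierInv hh.integrable
    fun_prop
  have hgi : Integrable g := by
    refine ((integrable_envelope (b := (1 : ℂ).re) (by simp) (s - ⟪x, η⟫)).mul_const
      (∫ ξ, ‖h ξ‖)).mono' hgc.aestronglyMeasurable
      (Filter.Eventually.of_forall (hh.norm_le_envelope hη x 1))
  have hF : 𝓕 g = 0 := by
    ext σ
    rw [Real.fourier_real_eq_integral_exp_smul]
    -- On the line Re l = 1 the Laplace transform at 1 - iσ is the Fourier transform of `g` at σ.
    have := hh.lineLaplace_eq_zero (x₀ := x) (l := 1 - Complex.I * σ) hη (by simp) hψm hψ0 hint hI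
    rw [lineLaplace] at this
    rw [Pi.zero_apply, ← this]
    congr 1; ext u
    simp only [g]
    rw [smul_eq_mul, ← mul_assoc, ← Complex.exp_add]
    congr 2; push_cast; ring
  have h0 := hgc.fourierInv_fourier_eq hgi (by rw [hF]; exact integrable_zero _ _ _)
  have h1 : g 0 = 0 := by
    rw [← h0, hF, fourierInv_eq_integral_exp]; simp
  simpa [g] using h1

end LogIntegral

/-! ### Smoothing the transform of an L^p function, and the uniqueness theorem. -/

section Uniqueness

open scoped SchwartzMap ContDiff

variable {V : Type*} [NormedAddCommGroup V] [InnerProductSpace ℝ V] [FiniteDimensional ℝ V]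
  [MeasurableSpace V] [BorelSpace V]

theorem exists_schwartz_mul_rpow_le (φ : 𝓢(V, ℂ)) (M : ℝ) :
    ∃ C, ∀ ξ, ‖φ ξ‖ * (1 + ‖ξ‖) ^ M ≤ C := by
  obtain ⟨k, hk⟩ := exists_nat_ge M
  refine ⟨_, fun ξ ↦ le_trans ?_ (SchwartzMap.one_add_le_sup_seminorm_apply (𝕜 := ℝ)
    (m := (k, 0)) le_rfl le_rfl φ ξ)⟩
  rw [norm_iteratedFDeriv_zero, mul_comm, ← Real.rpow_natCast]
  gcongr
  linarith [norm_nonneg ξ]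

theorem integrable_schwartz_mul_rpow (φ : 𝓢(V, ℂ)) (M : ℝ) :
    Integrable fun ξ ↦ ‖φ ξ‖ * (1 + ‖ξ‖) ^ M := by
  set r : ℝ := Module.finrank ℝ V + 1
  obtain ⟨C, hC⟩ := exists_schwartz_mul_rpow_le φ (M + r)
  refine ((integrable_one_add_norm (E := V) (μ := volume) (r := r)
    (by simp [r])).const_mul C).mono' ?_ (Filter.Eventually.of_forall fun ξ ↦ ?_)
  · have := φ.continuous
    exact (by fun_prop : Measurable _).aestronglyMeasurable
  · have h0 : 0 < 1 + ‖ξ‖ := by positivity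
    rw [Real.norm_of_nonneg (by positivity), Real.rpow_neg h0.le, ← div_eq_mul_inv,
      le_div_iff₀ (by positivity), mul_assoc, ← Real.rpow_add h0]
    exact hC ξ

/-- The Fourier transforms of an integrable function and of a Schwartz function are dual. -/
theorem integral_fourier_mul_schwartz {f : V → ℂ} (hf : Integrable f) (φ : 𝓢(V, ℂ)) :
    ∫ ξ, 𝓕 f ξ * φ ξ = ∫ x, f x * 𝓕 φ x := by
  have := VectorFourier.integral_fourierIntegral_smul_eq_flip (L := innerₗ V)
    Real.continuous_fourierChar continuous_inner hf (φ.integrable (μ := volume))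
  rw [flip_innerₗ] at this
  simpa only [smul_eq_mul] using! this

/-- The same in `L²`. -/
theorem integral_fourierL2_mul_schwartz (f : Lp ℂ 2 (volume : Measure V)) (φ : 𝓢(V, ℂ)) :
    ∫ ξ, (𝓕 f : Lp ℂ 2 (volume : Measure V)) ξ * φ ξ = ∫ x, f x * 𝓕 φ x := by
  have := congrArg (fun T ↦ T φ) (Lp.fourier_toTemperedDistribution_eq f)
  simp only [TemperedDistribution.fourier_apply, Lp.toTemperedDistribution_apply] at this
  simpa only [smul_eq_mul, mul_comm] using this.symm

theorem norm_fourier_le (f : V → ℂ) (ξ : V) : ‖𝓕 f ξ‖ ≤ ∫ x, ‖f x‖ :=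
  VectorFourier.norm_fourierIntegral_le_integral_norm _ _ _ f ξ

theorem continuous_fourier {f : V → ℂ} (hf : Integrable f) : Continuous (𝓕 f) :=
  VectorFourier.fourierIntegral_continuous Real.continuous_fourierChar
    (L := innerₗ V) (by exact continuous_inner) hf

variable {d : ℕ}

local notation "E" => EuclideanSpace ℝ (Fin d)

theorem aestronglyMeasurable_fourierLp {p : ℝ≥0∞} (hp1 : 1 ≤ p) (hp2 : p ≤ 2)
    (f : Lp ℂ p (volume : Measure E)) : AEStronglyMeasurable (fourierLp hp1 hp2 f) volume :=
  (continuous_fourier (memLp_one_iff_integrable.1 (memLp_large hp1 hp2 f))).aestronglyMeasurable.add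
    (Lp.stronglyMeasurable _).aestronglyMeasurable

theorem integrable_fourierLp_mul {p : ℝ≥0∞} (hp1 : 1 ≤ p) (hp2 : p ≤ 2)
    (f : Lp ℂ p (volume : Measure E)) (φ : 𝓢(E, ℂ)) :
    Integrable fun ξ ↦ fourierLp hp1 hp2 f ξ * φ ξ := by
  have hL := memLp_one_iff_integrable.1 (memLp_large hp1 hp2 f)
  have h1 : Integrable fun ξ ↦ 𝓕 (large f) ξ * φ ξ :=
    φ.integrable.bdd_mul (c := ∫ x, ‖large f x‖) (continuous_fourier hL).aestronglyMeasurable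
      (Filter.Eventually.of_forall (norm_fourier_le _))
  have h2 : Integrable fun ξ ↦ (𝓕 ((memLp_small hp1 hp2 f).toLp (small f)) :
      Lp ℂ 2 (volume : Measure E)) ξ * φ ξ :=
    (Lp.memLp _).integrable_mul (φ.memLp 2)
  simpa only [fourierLp, add_mul] using! h1.add h2

theorem integral_fourierLp_mul {p : ℝ≥0∞} (hp1 : 1 ≤ p) (hp2 : p ≤ 2)
    (f : Lp ℂ p (volume : Measure E)) (φ : 𝓢(E, ℂ)) :
    ∫ ξ, fourierLp hp1 hp2 f ξ * φ ξ = ∫ x, f x * 𝓕 φ x := by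
  have hL := memLp_one_iff_integrable.1 (memLp_large hp1 hp2 f)
  have hS := memLp_small hp1 hp2 f
  have h1 : Integrable fun ξ ↦ 𝓕 (large f) ξ * φ ξ :=
    φ.integrable.bdd_mul (c := ∫ x, ‖large f x‖) (continuous_fourier hL).aestronglyMeasurable
      (Filter.Eventually.of_forall (norm_fourier_le _))
  have h2 : Integrable fun ξ ↦ (𝓕 (hS.toLp (small f)) : Lp ℂ 2 (volume : Measure E)) ξ * φ ξ :=
    (Lp.memLp _).integrable_mul (φ.memLp 2)
  have h3 : Integrable fun x ↦ large f x * 𝓕 φ x :=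
    hL.mul_bdd (c := ∫ x, ‖φ x‖) (𝓕 φ).continuous.aestronglyMeasurable
      (Filter.Eventually.of_forall (norm_fourier_le _))
  have h4 : Integrable fun x ↦ small f x * 𝓕 φ x := hS.integrable_mul ((𝓕 φ).memLp 2)
  have h5 : ∫ x, hS.toLp (small f) x * 𝓕 φ x = ∫ x, small f x * 𝓕 φ x :=
    integral_congr_ae (by filter_upwards [hS.coeFn_toLp] with x hx; rw [hx])
  simp only [fourierLp, add_mul]
  rw [integral_add h1 h2, integral_fourier_mul_schwartz hL, integral_fourierL2_mul_schwartz, h5,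
    ← integral_add h3 h4]
  congr 1; ext x
  rw [← add_mul]
  exact congrArg (· * _) (congrFun (large_add_small (f : E → ℂ)) x)

/-- The Schwartz function `y ↦ g (y - x)`. -/
def translate {g : V → ℝ} (hg : ContDiff ℝ ∞ g) (hgs : HasCompactSupport g) (x : V) : 𝓢(V, ℂ) :=
  HasCompactSupport.toSchwartzMap (f := fun y ↦ ((g (y - x) : ℝ) : ℂ))
    ((hgs.comp_homeomorph (Homeomorph.subRight x)).comp_left (g := fun t : ℝ ↦ (t : ℂ)) (by simp))
    (Complex.ofRealCLM.contDiff.comp (hg.comp (contDiff_id.sub contDiff_const)))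

theorem translate_apply {g : V → ℝ} (hg : ContDiff ℝ ∞ g) (hgs : HasCompactSupport g) (x y : V) :
    translate hg hgs x y = g (y - x) := rfl

theorem fourierInv_translate {g : V → ℝ} (hg : ContDiff ℝ ∞ g) (hgs : HasCompactSupport g)
    (x ξ : V) : 𝓕⁻ (translate hg hgs x) ξ =
      Complex.exp (2 * Real.pi * Complex.I * ⟪ξ, x⟫) * 𝓕⁻ (translate hg hgs 0) ξ := by
  simp only [SchwartzMap.fourierInv_coe, fourierInv_eq_integral_exp]
  rw [← integral_const_mul, ← integral_add_right_eq_self _ x]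
  congr 1; ext y
  rw [translate_apply, translate_apply, add_sub_cancel_right, sub_zero, ← mul_assoc,
    ← Complex.exp_add, inner_add_left, real_inner_comm ξ x]
  congr 2; push_cast; ring

/-- The smoothed Fourier transform of a function supported in a half-space has one-sided
spectrum. -/
theorem halfSpectrum_fourierLp_mul {p : ℝ≥0∞} (hp1 : 1 ≤ p) (hp2 : p ≤ 2)
    (f : Lp ℂ p (volume : Measure E)) {η : E} {s : ℝ} (hη : ‖η‖ = 1)
    (hf : ∀ᵐ x : E, s < ⟪x, η⟫ → f x = 0) {g : E → ℝ} (hg : ContDiff ℝ ∞ g)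
    (hgs : HasCompactSupport g) {R : ℝ} (hR : ∀ y, R < ‖y‖ → g y = 0) :
    HalfSpectrum η (s + R) (fun ξ ↦ fourierLp hp1 hp2 f ξ * 𝓕⁻ (translate hg hgs 0) ξ) ∧
    ∀ x, 𝓕⁻ (fun ξ ↦ fourierLp hp1 hp2 f ξ * 𝓕⁻ (translate hg hgs 0) ξ) x =
      ∫ y, f y * g (y - x) := by
  have key : ∀ x, 𝓕⁻ (fun ξ ↦ fourierLp hp1 hp2 f ξ * 𝓕⁻ (translate hg hgs 0) ξ) x =
      ∫ y, f y * g (y - x) := fun x ↦ by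
    -- Duality with the Schwartz function 𝓕⁻(translate of g) undoes the transform; the translation
    -- becomes the exponential in the inverse Fourier integral.
    have h1 := integral_fourierLp_mul hp1 hp2 f (𝓕⁻ (translate hg hgs x))
    rw [FourierTransform.fourier_fourierInv_eq] at h1
    simp only [translate_apply] at h1
    rw [← h1, fourierInv_eq_integral_exp]
    congr 1; ext ξ
    rw [fourierInv_translate hg hgs x]; ring
  refine ⟨⟨integrable_fourierLp_mul hp1 hp2 f _, fun x hx ↦ ?_⟩, key⟩
  rw [key]
  refine integral_eq_zero_of_ae ?_
  filter_upwards [hf] with y hy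
  by_cases hyx : R < ‖y - x‖
  · simp [hR _ hyx]
  · rw [hy, zero_mul, Pi.zero_apply]
    have h1 : |⟪x - y, η⟫| ≤ ‖x - y‖ * ‖η‖ := abs_real_inner_le_norm _ _
    rw [hη, mul_one, norm_sub_rev, inner_sub_left] at h1
    linarith [le_abs_self (⟪x, η⟫ - ⟪y, η⟫), not_lt.1 hyx]

/-- Split the polynomial weight as (1 + ‖ξ‖)^(±N/q) between the two factors. The elementary u ≤ 1 +
u^q then replaces Hölder's inequality. -/
theorem integrable_mul_exp_of_weightedLq {G : V → ℂ} (hG : AEStronglyMeasurable G volume)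
    (φ : 𝓢(V, ℂ)) {w : V → ℝ} (hw : AEStronglyMeasurable w volume) {q N : ℝ} (hq : 1 ≤ q)
    (h : ∫⁻ ξ, ENNReal.ofReal (‖G ξ‖ ^ q * Real.exp (q * w ξ) / (1 + ‖ξ‖) ^ N) < (⊤ : ℝ≥0∞)) :
    Integrable fun ξ ↦ ‖G ξ * φ ξ‖ * Real.exp (w ξ) := by
  have hq0 : 0 < q := by linarith
  have hGm := hG.norm.aemeasurable
  have hwm := hw.aemeasurable
  have hφm : Measurable φ := φ.continuous.measurable
  obtain ⟨C, hC⟩ := exists_schwartz_mul_rpow_le φ (N / q)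
  have hI : Integrable fun ξ ↦ ‖G ξ‖ ^ q * Real.exp (q * w ξ) / (1 + ‖ξ‖) ^ N := by
    refine (lintegral_ofReal_ne_top_iff_integrable ?_ (Filter.Eventually.of_forall fun ξ ↦ ?_)).1
      h.ne
    · exact (by fun_prop : AEMeasurable _ volume).aestronglyMeasurable
    · simp only [Pi.zero_apply]; positivity
  refine ((integrable_schwartz_mul_rpow φ (N / q)).add (hI.const_mul C)).mono' ?_
    (Filter.Eventually.of_forall fun ξ ↦ ?_)
  · exact (hG.mul hφm.aestronglyMeasurable).norm.mul
      (Real.continuous_exp.comp_aestronglyMeasurable hw)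
  · have h0 : 0 < 1 + ‖ξ‖ := by positivity
    set u := ‖G ξ‖ * Real.exp (w ξ) * (1 + ‖ξ‖) ^ (-(N / q))
    set v := ‖φ ξ‖ * (1 + ‖ξ‖) ^ (N / q)
    have hu0 : 0 ≤ u := by positivity
    have hv0 : 0 ≤ v := by positivity
    have huq : ‖G ξ‖ ^ q * Real.exp (q * w ξ) / (1 + ‖ξ‖) ^ N = u ^ q := by
      simp only [u]
      rw [Real.mul_rpow (by positivity) (by positivity),
        Real.mul_rpow (by positivity) (by positivity), ← Real.exp_mul, ← Real.rpow_mul h0.le,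
        neg_mul, div_mul_cancel₀ _ hq0.ne', Real.rpow_neg h0.le, mul_comm q, div_eq_mul_inv]
    have huv : ‖‖G ξ * φ ξ‖ * Real.exp (w ξ)‖ = u * v := by
      rw [Real.norm_of_nonneg (by positivity), norm_mul]
      have : (1 + ‖ξ‖) ^ (-(N / q)) * (1 + ‖ξ‖) ^ (N / q) = 1 := by
        rw [← Real.rpow_add h0, neg_add_cancel, Real.rpow_zero]
      simp only [u, v]
      linear_combination (-(‖G ξ‖ * ‖φ ξ‖ * Real.exp (w ξ))) * this
    rw [huv, Pi.add_apply, huq]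
    have hu1 : u ≤ 1 + u ^ q := by
      rcases le_total u 1 with h1 | h1
      · have := Real.rpow_nonneg hu0 q
        linarith
      · have := Real.self_le_rpow_of_one_le h1 hq
        linarith
    have := hC ξ
    calc u * v ≤ (1 + u ^ q) * v := by gcongr
      _ = v + v * u ^ q := by ring
      _ ≤ v + C * u ^ q := by gcongr

theorem integrable_mul_exp_of_pointwiseDecay {G : V → ℂ} (hG : AEStronglyMeasurable G volume)
    (φ : 𝓢(V, ℂ)) {w : V → ℝ} (hw : AEStronglyMeasurable w volume) {C N : ℝ}
    (h : ∀ᵐ ξ, ‖G ξ‖ ≤ C * (1 + ‖ξ‖) ^ N * Real.exp (-w ξ)) :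
    Integrable fun ξ ↦ ‖G ξ * φ ξ‖ * Real.exp (w ξ) := by
  refine ((integrable_schwartz_mul_rpow φ N).const_mul C).mono' ?_ ?_
  · exact (hG.mul φ.continuous.aestronglyMeasurable).norm.mul
      (Real.continuous_exp.comp_aestronglyMeasurable hw)
  · filter_upwards [h] with ξ hξ
    rw [Real.norm_of_nonneg (by positivity), norm_mul]
    calc ‖G ξ‖ * ‖φ ξ‖ * Real.exp (w ξ)
        ≤ C * (1 + ‖ξ‖) ^ N * Real.exp (-w ξ) * ‖φ ξ‖ * Real.exp (w ξ) := by gcongr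
      _ = C * (‖φ ξ‖ * (1 + ‖ξ‖) ^ N) * (Real.exp (-w ξ) * Real.exp (w ξ)) := by ring
      _ = C * (‖φ ξ‖ * (1 + ‖ξ‖) ^ N) := by rw [← Real.exp_add]; simp

/-- The weight is only almost everywhere measurable on the half-line and unconstrained off it, while
the Jensen argument uses a measurable weight that is nonnegative everywhere. -/
theorem exists_measurable_weight {ψ : ℝ → ℝ} (hψ0 : ∀ t ∈ Ici (0 : ℝ), 0 ≤ ψ t)
    (hψ : LocallyIntegrableOn ψ (Ici (0 : ℝ)) volume) :
    ∃ ψ' : ℝ → ℝ, Measurable ψ' ∧ (∀ t, 0 ≤ ψ' t) ∧ logIntegral ψ' = logIntegral ψ ∧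
      ∀ᵐ t : ℝ, ψ' |t| = ψ |t| := by
  have hm := hψ.aestronglyMeasurable
  have hae : ∀ᵐ t : ℝ, t ∈ Ici (0 : ℝ) → max (hm.mk ψ t) 0 = ψ t := by
    filter_upwards [(ae_restrict_iff' measurableSet_Ici).1 hm.ae_eq_mk] with t ht ht0
    rw [← ht ht0, max_eq_left (hψ0 t ht0)]
  refine ⟨fun t ↦ max (hm.mk ψ t) 0, hm.stronglyMeasurable_mk.measurable.max measurable_const,
    fun t ↦ le_max_right _ _, ?_, ?_⟩
  · refine setLIntegral_congr_fun_ae measurableSet_Ioi ?_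
    filter_upwards [hae] with t ht ht1
    have h1 : (1 : ℝ) < t := ht1
    rw [ht (mem_Ici.2 (by linarith))]
  · filter_upwards [hae, (Measure.measurePreserving_neg (volume : Measure ℝ)).quasiMeasurePreserving.ae hae]
      with t h1 h2
    rcases le_total 0 t with h | h
    · rw [abs_of_nonneg h, h1 h]
    · rw [abs_of_nonpos h, h2 (neg_nonneg.2 h)]

/-- A function in `L^p(ℝ^d)`, `1 ≤ p ≤ 2`, that is supported in a half-space and whose Fourier
transform decays with divergent logarithmic integral, vanishes. -/
theorem eq_zero_of_logIntegral_eq_top {ψ : ℝ → ℝ} (hψ0 : ∀ t ∈ Ici (0 : ℝ), 0 ≤ ψ t)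
    (hψ : LocallyIntegrableOn ψ (Ici (0 : ℝ)) volume) {p : ℝ≥0∞} (hp1 : 1 ≤ p) (hp2 : p ≤ 2)
    (f : Lp ℂ p (volume : Measure E)) {η : E} {s : ℝ} (hη : ‖η‖ = 1)
    (hf : ∀ᵐ x : E, s < ⟪x, η⟫ → f x = 0)
    (hdecay : (∃ q N : ℝ, 1 ≤ q ∧ 0 ≤ N ∧ WeightedLq ψ η q N (fourierLp hp1 hp2 f)) ∨
      (∃ C N : ℝ, 0 ≤ N ∧ PointwiseDecay ψ η C N (fourierLp hp1 hp2 f)))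
    (hI : logIntegral ψ = (⊤ : ℝ≥0∞)) : f = 0 := by
  obtain ⟨ψ', hm, h0, hlog, hae⟩ := exists_measurable_weight hψ0 hψ
  have haeξ : ∀ᵐ ξ : E, ψ' |⟪ξ, η⟫| = ψ |⟪ξ, η⟫| := (quasiMeasurePreserving_inner hη).ae hae
  have hw : AEStronglyMeasurable (fun ξ : E ↦ ψ' |⟪ξ, η⟫|) volume :=
    (by fun_prop : Measurable _).aestronglyMeasurable
  have hG := aestronglyMeasurable_fourierLp hp1 hp2 f
  have hint : ∀ φ : 𝓢(E, ℂ), Integrable fun ξ ↦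
      ‖fourierLp hp1 hp2 f ξ * φ ξ‖ * Real.exp (ψ' |⟪ξ, η⟫|) := fun φ ↦ by
    rcases hdecay with ⟨q, N, hq, -, h⟩ | ⟨C, N, -, h⟩
    · refine integrable_mul_exp_of_weightedLq hG φ hw (N := N) hq ?_
      rw [WeightedLq] at h
      rwa [lintegral_congr_ae (by filter_upwards [haeξ] with ξ hξ; rw [hξ])]
    · refine integrable_mul_exp_of_pointwiseDecay hG φ hw (C := C) (N := N) ?_
      filter_upwards [h, haeξ] with ξ h1 h2
      rwa [h2]
  rw [Lp.eq_zero_iff_ae_eq_zero]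
  refine ae_eq_zero_of_integral_contDiff_smul_eq_zero
    ((Lp.memLp f).locallyIntegrable hp1) fun g hg hgs ↦ ?_
  obtain ⟨R, hR⟩ := hgs.isCompact.isBounded.exists_norm_le
  have hR' : ∀ y, R < ‖y‖ → g y = 0 := fun y hy ↦
    image_eq_zero_of_notMem_tsupport fun h ↦ (hR y h).not_gt hy
  obtain ⟨h1, h2⟩ := halfSpectrum_fourierLp_mul hp1 hp2 f hη hf hg hgs hR'
  -- At the point 0 the correlation is exactly the pairing of `f` with `g`.
  have h3 := h1.fourierInv_eq_zero hη hm h0 (hint _) (hlog.trans hI) 0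
  rw [h2] at h3
  simpa only [sub_zero, Complex.real_smul, mul_comm] using h3

end Uniqueness

/-! ### Infinite products of bump transforms with prescribed decay. -/

section Existence

open scoped SchwartzMap

variable {V : Type*} [NormedAddCommGroup V] [InnerProductSpace ℝ V] [FiniteDimensional ℝ V]
  [MeasurableSpace V] [BorelSpace V]

/-- A smooth probability density supported in the closed unit ball. -/
def density (V : Type*) [NormedAddCommGroup V] [InnerProductSpace ℝ V] [FiniteDimensional ℝ V]
    [MeasurableSpace V] [BorelSpace V] : V → ℝ :=
  (⟨1 / 2, 1, by norm_num, by norm_num⟩ : ContDiffBump (0 : V)).normed volume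

theorem contDiff_density : ContDiff ℝ (⊤ : ℕ∞) (density V) := ContDiffBump.contDiff_normed _

theorem hasCompactSupport_density : HasCompactSupport (density V) :=
  ContDiffBump.hasCompactSupport_normed _

theorem density_nonneg (u : V) : 0 ≤ density V u := ContDiffBump.nonneg_normed _ u

theorem integral_density : ∫ u, density V u = 1 := ContDiffBump.integral_normed _

theorem integrable_density : Integrable (density V) := ContDiffBump.integrable_normed _

theorem density_eq_zero {u : V} (hu : 1 < ‖u‖) : density V u = 0 := by
  by_contra h
  have : u ∈ Function.support (density V) := h
  rw [density, ContDiffBump.support_normed_eq, mem_ball_zero_iff] at this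
  exact this.not_gt hu

/-- The Fourier transform of `density V`. -/
def symbol (V : Type*) [NormedAddCommGroup V] [InnerProductSpace ℝ V] [FiniteDimensional ℝ V]
    [MeasurableSpace V] [BorelSpace V] : 𝓢(V, ℂ) :=
  𝓕 (translate (contDiff_density (V := V)) hasCompactSupport_density 0)

theorem fourierInv_symbol (x : V) : 𝓕⁻ (symbol V : V → ℂ) x = density V x := by
  rw [← SchwartzMap.fourierInv_coe, symbol, FourierTransform.fourierInv_fourier_eq,
    translate_apply, sub_zero]

theorem symbol_eq (ξ : V) :
    symbol V ξ = ∫ u, Complex.exp (2 * Real.pi * Complex.I * (-⟪u, ξ⟫ : ℝ)) * density V u := by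
  rw [symbol, SchwartzMap.fourier_coe, Real.fourier_eq']
  congr 1; ext u
  rw [smul_eq_mul, translate_apply, sub_zero]
  congr 2; push_cast; ring

theorem norm_symbol_le_one (ξ : V) : ‖symbol V ξ‖ ≤ 1 := by
  rw [symbol_eq, ← integral_density (V := V)]
  refine norm_integral_le_of_norm_le integrable_density (Filter.Eventually.of_forall fun u ↦ ?_)
  rw [norm_mul, norm_exp_two_pi_I, one_mul, Complex.norm_real,
    Real.norm_of_nonneg (density_nonneg u)]

theorem symbol_zero : symbol V 0 = 1 := by
  rw [symbol_eq]
  simp only [inner_zero_right, neg_zero, Complex.ofReal_zero, mul_zero, Complex.exp_zero, one_mul]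
  rw [integral_complex_ofReal, integral_density, Complex.ofReal_one]

/-- Follows from |exp(iθ) - 1| ≤ |θ| and the support of the density in the unit ball. This linear
bound at the origin makes the infinite product converge. -/
theorem norm_symbol_sub_one_le (ξ : V) : ‖symbol V ξ - 1‖ ≤ 2 * Real.pi * ‖ξ‖ := by
  have h1 : symbol V ξ - 1 = ∫ u,
      (Complex.exp (2 * Real.pi * Complex.I * (-⟪u, ξ⟫ : ℝ)) - 1) * density V u := by
    have e : (1 : ℂ) = ∫ u, (density V u : ℂ) := by
      rw [integral_complex_ofReal, integral_density, Complex.ofReal_one]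
    rw [symbol_eq]
    conv_lhs => rw [e]
    rw [← integral_sub]
    · congr 1; ext u; ring
    · refine integrable_density.ofReal.bdd_mul (c := 1) ?_
        (Filter.Eventually.of_forall fun u ↦ (norm_exp_two_pi_I _).le)
      exact (by fun_prop : Measurable _).aestronglyMeasurable
    · exact integrable_density.ofReal
  have h2 : 2 * Real.pi * ‖ξ‖ = ∫ u, 2 * Real.pi * ‖ξ‖ * density V u := by
    rw [integral_const_mul, integral_density, mul_one]
  rw [h1, h2]
  refine norm_integral_le_of_norm_le (integrable_density.const_mul _)
    (Filter.Eventually.of_forall fun u ↦ ?_)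
  rw [norm_mul, Complex.norm_real, Real.norm_of_nonneg (density_nonneg u)]
  rcases le_or_gt ‖u‖ 1 with hu | hu
  · refine mul_le_mul_of_nonneg_right ?_ (density_nonneg u)
    have := Real.norm_exp_I_mul_ofReal_sub_one_le (x := 2 * Real.pi * -⟪u, ξ⟫)
    have e : Complex.I * ((2 * Real.pi * -⟪u, ξ⟫ : ℝ) : ℂ) =
        2 * Real.pi * Complex.I * (-⟪u, ξ⟫ : ℝ) := by push_cast; ring
    rw [e] at this
    refine this.trans ?_
    rw [norm_mul, Real.norm_of_nonneg (by positivity), norm_neg]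
    gcongr
    exact (norm_inner_le_norm u ξ).trans (mul_le_of_le_one_left (norm_nonneg _) hu)
  · simp [density_eq_zero hu]

theorem exists_norm_symbol_le : ∃ R : ℝ, 0 < R ∧ ∀ ξ : V, R ≤ ‖ξ‖ → ‖symbol V ξ‖ ≤ Real.exp (-1) := by
  obtain ⟨C, hC⟩ := exists_schwartz_mul_rpow_le (symbol V) 1
  -- `C` bounds ‖symbol‖ (1 + ‖ξ‖), so beyond radius C e the symbol is at most 1/e; the 1 only
  -- secures positivity.
  refine ⟨max 1 (C * Real.exp 1), by positivity, fun ξ hξ ↦ ?_⟩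
  have h1 : C * Real.exp 1 ≤ 1 + ‖ξ‖ := by linarith [(le_max_right _ _).trans hξ]
  have h2 := hC ξ
  rw [Real.rpow_one] at h2
  have h0 : 0 < 1 + ‖ξ‖ := by positivity
  rw [Real.exp_neg, ← one_div, le_div_iff₀ (Real.exp_pos 1)]
  by_contra! h
  have h3 := mul_lt_mul_of_pos_right h h0
  have h4 := mul_le_mul_of_nonneg_right h2 (Real.exp_pos 1).le
  nlinarith

/-- Multiplication by a dilated `symbol` averages the inverse Fourier transform. -/
theorem fourierInv_symbol_mul {F : V → ℂ} (hF : Integrable F) (a : ℝ) (x : V) :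
    𝓕⁻ (fun ξ ↦ symbol V (a • ξ) * F ξ) x = ∫ u, density V u * 𝓕⁻ F (x - a • u) := by
  simp only [fourierInv_eq_integral_exp, symbol_eq]
  simp only [← integral_const_mul, ← integral_mul_const]
  rw [integral_integral_swap]
  · congr 1; ext u
    congr 1; ext ξ
    have : Complex.exp (2 * Real.pi * Complex.I * (⟪ξ, x - a • u⟫ : ℝ)) =
        Complex.exp (2 * Real.pi * Complex.I * (⟪ξ, x⟫ : ℝ)) *
          Complex.exp (2 * Real.pi * Complex.I * (-⟪u, a • ξ⟫ : ℝ)) := by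
      rw [← Complex.exp_add, inner_sub_right, real_inner_smul_right, real_inner_smul_right,
        real_inner_comm u ξ]
      congr 1; push_cast; ring
    rw [this]; ring
  · refine (hF.norm.mul_prod (integrable_density (V := V))).mono' ?_
      (Filter.Eventually.of_forall fun p ↦ ?_)
    · refine AEStronglyMeasurable.mul ?_ (AEStronglyMeasurable.mul (AEStronglyMeasurable.mul ?_ ?_) ?_)
      · exact (by fun_prop : Measurable _).aestronglyMeasurable
      · exact (by fun_prop : Measurable _).aestronglyMeasurable
      · exact integrable_density.ofReal.aestronglyMeasurable.comp_snd
      · exact hF.aestronglyMeasurable.comp_fst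
    · simp only [Function.uncurry, norm_mul, norm_exp_two_pi_I, one_mul, Complex.norm_real,
        Real.norm_of_nonneg (density_nonneg _)]
      rw [mul_comm]

/-- `F` is continuous, dominated by `symbol V`, and `𝓕⁻ F` vanishes outside the ball of radius
`r`. -/
structure BandLimited (F : V → ℂ) (r : ℝ) : Prop where
  continuous : Continuous F
  norm_le : ∀ ξ, ‖F ξ‖ ≤ ‖symbol V ξ‖
  vanish : ∀ x, r < ‖x‖ → 𝓕⁻ F x = 0

namespace BandLimited

theorem integrable {F : V → ℂ} {r : ℝ} (hF : BandLimited F r) : Integrable F :=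
  (symbol V).integrable.mono hF.continuous.aestronglyMeasurable
    (Filter.Eventually.of_forall hF.norm_le)

/-- The new inverse transform at x averages the old one over the ball of radius `a` about x, so the
support radius grows by at most `a`. -/
theorem symbol_mul {F : V → ℂ} {r a : ℝ} (hF : BandLimited F r) (ha : 0 ≤ a) :
    BandLimited (fun ξ ↦ symbol V (a • ξ) * F ξ) (r + a) := by
  refine ⟨((symbol V).continuous.comp (continuous_const_smul a)).mul hF.continuous, fun ξ ↦ ?_,
    fun x hx ↦ ?_⟩
  · rw [norm_mul]
    exact (mul_le_of_le_one_left (norm_nonneg _) (norm_symbol_le_one _)).trans (hF.norm_le ξ)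
  · rw [fourierInv_symbol_mul hF.integrable]
    refine integral_eq_zero_of_ae (Filter.Eventually.of_forall fun u ↦ ?_)
    rcases le_or_gt ‖u‖ 1 with hu | hu
    · have h1 : ‖a • u‖ ≤ a := by
        rw [norm_smul, Real.norm_of_nonneg ha]; exact mul_le_of_le_one_right ha hu
      have h2 := norm_sub_norm_le x (a • u)
      change (density V u : ℂ) * 𝓕⁻ F (x - a • u) = 0
      rw [hF.vanish _ (by linarith), mul_zero]
    · simp [density_eq_zero hu]

theorem symbol_pow_mul {F : V → ℂ} {r a : ℝ} (hF : BandLimited F r) (ha : 0 ≤ a) (n : ℕ) :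
    BandLimited (fun ξ ↦ symbol V (a • ξ) ^ n * F ξ) (r + n * a) := by
  induction n with
  | zero => simpa using hF
  | succ n ih =>
    convert ih.symbol_mul ha using 1
    · ext ξ; ring
    · push_cast; ring

theorem of_symbol : BandLimited (symbol V) 1 :=
  ⟨(symbol V).continuous, fun _ ↦ le_rfl, fun x hx ↦ by
    rw [fourierInv_symbol, density_eq_zero hx, Complex.ofReal_zero]⟩

theorem prod (a : ℕ → ℝ) (ha : ∀ j, 0 ≤ a j) (n : ℕ → ℕ) (m : ℕ) :
    BandLimited (fun ξ : V ↦ (∏ j ∈ Finset.range m, symbol V (a j • ξ) ^ n j) *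
      symbol V ξ) (1 + ∑ j ∈ Finset.range m, n j * a j) := by
  induction m with
  | zero => simpa using of_symbol
  | succ m ih =>
    convert ih.symbol_pow_mul (ha m) (n m) using 1
    · ext ξ; rw [Finset.prod_range_succ]; ring
    · rw [Finset.sum_range_succ]; ring

/-- A pointwise limit of band limited functions with uniformly bounded bands is the Fourier
transform of a continuous function supported in a ball. -/
theorem fourier_fourierInv_lim {F : ℕ → V → ℂ} {r : ℝ} (hF : ∀ m, BandLimited (F m) r) {G : V → ℂ}
    (hG : ∀ ξ, Filter.Tendsto (fun m ↦ F m ξ) Filter.atTop (nhds (G ξ))) :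
    Integrable G ∧ (∀ x, r < ‖x‖ → 𝓕⁻ G x = 0) ∧ 𝓕 (𝓕⁻ G) = G := by
  have hGi : Integrable G := by
    refine (symbol V).integrable.mono (aestronglyMeasurable_of_tendsto_ae Filter.atTop
      (fun m ↦ (hF m).continuous.aestronglyMeasurable) (Filter.Eventually.of_forall hG))
      (Filter.Eventually.of_forall fun ξ ↦ ?_)
    exact le_of_tendsto' (hG ξ).norm fun m ↦ (hF m).norm_le ξ
  have hlim : ∀ x, Filter.Tendsto (fun m ↦ 𝓕⁻ (F m) x) Filter.atTop (nhds (𝓕⁻ G x)) := fun x ↦ by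
    simp only [fourierInv_eq_integral_exp]
    refine tendsto_integral_of_dominated_convergence (fun ξ ↦ ‖symbol V ξ‖) (fun m ↦ ?_)
      (symbol V).integrable.norm (fun m ↦ Filter.Eventually.of_forall fun ξ ↦ ?_)
      (Filter.Eventually.of_forall fun ξ ↦ (hG ξ).const_mul _)
    · have := (hF m).continuous.measurable
      exact (by fun_prop : Measurable _).aestronglyMeasurable
    · rw [norm_mul, norm_exp_two_pi_I, one_mul]; exact (hF m).norm_le ξ
  have hvan : ∀ x, r < ‖x‖ → 𝓕⁻ G x = 0 := fun x hx ↦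
    tendsto_nhds_unique (hlim x) (by simp only [(hF _).vanish x hx]; exact tendsto_const_nhds)
  refine ⟨hGi, hvan, ?_⟩
  -- Continuity of `G` is not assumed, so inversion is proved for each `F m` and passed to the
  -- limit; `b` is a common integrable majorant of the 𝓕⁻ (F m).
  set b : V → ℝ := (Metric.closedBall 0 r).indicator fun _ ↦ ∫ ξ, ‖symbol V ξ‖
  have hb : Integrable b := by
    refine (integrable_indicator_iff measurableSet_closedBall).2 ?_
    exact integrableOn_const (measure_closedBall_lt_top.ne)
  have hle : ∀ m x, ‖𝓕⁻ (F m) x‖ ≤ b x := fun m x ↦ by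
    by_cases hx : ‖x‖ ≤ r
    · simp only [b]
      rw [indicator_of_mem (by simpa using hx)]
      exact (norm_fourierInv_le _ _).trans
        (integral_mono (hF m).integrable.norm (symbol V).integrable.norm (hF m).norm_le)
    · rw [(hF m).vanish x (not_le.1 hx), norm_zero]
      exact indicator_nonneg (fun _ _ ↦ integral_nonneg fun _ ↦ norm_nonneg _) x
  have hFi : ∀ m, Integrable (𝓕⁻ (F m)) := fun m ↦
    hb.mono' (continuous_fourierInv (hF m).integrable).aestronglyMeasurable
      (Filter.Eventually.of_forall (hle m))
  have hinv : ∀ m, 𝓕 (𝓕⁻ (F m)) = F m := fun m ↦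
    (hF m).continuous.fourier_fourierInv_eq (hF m).integrable
      (by
        have : 𝓕 (F m) = fun x ↦ 𝓕⁻ (F m) (-x) := by
          ext x; rw [Real.fourierInv_eq_fourier_neg, neg_neg]
        rw [this]; exact (hFi m).comp_neg)
  ext ξ
  refine tendsto_nhds_unique ?_ (hG ξ)
  have : (fun m ↦ F m ξ) = fun m ↦ 𝓕 (𝓕⁻ (F m)) ξ := by ext m; rw [hinv]
  rw [this]
  simp only [Real.fourier_eq']
  refine tendsto_integral_of_dominated_convergence b (fun m ↦ ?_) hb
    (fun m ↦ Filter.Eventually.of_forall fun x ↦ ?_)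
    (Filter.Eventually.of_forall fun x ↦ (hlim x).const_smul _)
  · have := (continuous_fourierInv (hF m).integrable).measurable
    exact (by fun_prop : Measurable _).aestronglyMeasurable
  · rw [norm_smul, Complex.norm_exp_ofReal_mul_I, one_mul]; exact hle m x

end BandLimited

theorem norm_pow_sub_one_le {z : ℂ} (hz : ‖z‖ ≤ 1) (n : ℕ) : ‖z ^ n - 1‖ ≤ n * ‖z - 1‖ := by
  induction n with
  | zero => simp
  | succ n ih =>
    have e : z ^ (n + 1) - 1 = z * (z ^ n - 1) + (z - 1) := by ring
    rw [e]
    refine (norm_add_le _ _).trans ?_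
    rw [norm_mul]
    push_cast
    linarith [mul_le_of_le_one_left (norm_nonneg (z ^ n - 1)) hz]

/-- There are nonzero continuous compactly supported functions whose Fourier transforms decay at
prescribed dyadic rates. -/
theorem exists_fourier_dyadic_decay (n : ℕ → ℕ) (hn : Summable fun j ↦ (n j : ℝ) / 2 ^ j) :
    ∃ f : V → ℂ, Continuous f ∧ HasCompactSupport f ∧ f ≠ 0 ∧
      (∀ ξ, ‖𝓕 f ξ‖ ≤ ‖symbol V ξ‖) ∧
      ∀ j ξ, 2 ^ j ≤ ‖ξ‖ → ‖𝓕 f ξ‖ ≤ ‖symbol V ξ‖ * Real.exp (-n j) := by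
  obtain ⟨R, hR, hsymb⟩ := exists_norm_symbol_le (V := V)
  -- With this dilation, ‖ξ‖ ≥ 2^j puts `a j • ξ` outside the radius `R` where the symbol drops to
  -- 1/e.
  set a : ℕ → ℝ := fun j ↦ R / 2 ^ j
  have ha : ∀ j, 0 ≤ a j := fun j ↦ by positivity
  have hsum : Summable fun j ↦ (n j : ℝ) * a j := by
    refine (hn.mul_left R).congr fun j ↦ ?_
    simp only [a]; ring
  set P : V → ℕ → ℂ := fun ξ j ↦ symbol V (a j • ξ) ^ n j
  have hP1 : ∀ ξ j, ‖P ξ j‖ ≤ 1 := fun ξ j ↦ by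
    rw [norm_pow]; exact pow_le_one₀ (norm_nonneg _) (norm_symbol_le_one _)
  have hmul : ∀ ξ, Multipliable (P ξ) := fun ξ ↦ by
    have h1 : Summable fun j ↦ ‖P ξ j - 1‖ := by
      refine Summable.of_nonneg_of_le (fun _ ↦ norm_nonneg _) (fun j ↦ ?_)
        (hsum.mul_left (2 * Real.pi * ‖ξ‖))
      refine (norm_pow_sub_one_le (norm_symbol_le_one _) _).trans ?_
      have h2 := norm_symbol_sub_one_le (a j • ξ)
      rw [norm_smul, Real.norm_of_nonneg (ha j)] at h2
      calc _ ≤ (n j : ℝ) * (2 * Real.pi * (a j * ‖ξ‖)) := by gcongr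
        _ = _ := by ring
    simpa using Complex.multipliable_one_add_of_summable h1.of_norm
  set F : ℕ → V → ℂ := fun m ξ ↦ (∏ j ∈ Finset.range m, P ξ j) * symbol V ξ
  set G : V → ℂ := fun ξ ↦ (∏' j, P ξ j) * symbol V ξ
  have hG : ∀ ξ, Filter.Tendsto (fun m ↦ F m ξ) Filter.atTop (nhds (G ξ)) := fun ξ ↦
    (hmul ξ).hasProd.tendsto_prod_nat.mul_const _
  have hF : ∀ m, BandLimited (F m) (1 + ∑' j, (n j : ℝ) * a j) := fun m ↦ by
    have h1 := BandLimited.prod (V := V) a ha n m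
    refine ⟨h1.continuous, h1.norm_le, fun x hx ↦ h1.vanish x (lt_of_le_of_lt ?_ hx)⟩
    have := hsum.sum_le_tsum (Finset.range m) fun j _ ↦ mul_nonneg (n j).cast_nonneg (ha j)
    linarith
  obtain ⟨hGi, hvan, hinv⟩ := BandLimited.fourier_fourierInv_lim hF hG
  refine ⟨𝓕⁻ G, continuous_fourierInv hGi,
    HasCompactSupport.of_support_subset_isCompact (isCompact_closedBall 0 (1 + ∑' j, (n j : ℝ) * a j))
      fun x hx ↦ ?_,
    fun h ↦ ?_, fun ξ ↦ ?_, fun j ξ hξ ↦ ?_⟩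
  · rw [mem_closedBall_zero_iff]
    by_contra hxr
    exact hx (hvan x (not_le.1 hxr))
  -- If 𝓕⁻ G vanished, so would G(0); but every factor equals 1 at the origin.
  · have h1 : G 0 = 0 := by
      rw [← hinv, h, Real.fourier_eq']; simp
    simp [G, P, symbol_zero] at h1
  · rw [hinv]
    exact le_of_tendsto' (hG ξ).norm fun m ↦ (hF m).norm_le ξ
  · rw [hinv]
    refine le_of_tendsto (hG ξ).norm ?_
    filter_upwards [Filter.eventually_gt_atTop j] with m hm
    have h1 : ‖P ξ j‖ ≤ Real.exp (-n j) := by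
      have h2 : ‖symbol V (a j • ξ)‖ ≤ Real.exp (-1) := by
        refine hsymb _ ?_
        rw [norm_smul, Real.norm_of_nonneg (ha j)]
        simp only [a]
        rw [div_mul_eq_mul_div, le_div_iff₀ (by positivity)]
        gcongr
      rw [norm_pow]
      refine (pow_le_pow_left₀ (norm_nonneg _) h2 _).trans_eq ?_
      rw [← Real.exp_nat_mul]; ring_nf
    -- Only the factor of index `j` is used; the others have norm at most 1.
    have h3 : ‖∏ i ∈ Finset.range m, P ξ i‖ ≤ Real.exp (-n j) := by
      rw [norm_prod, ← Finset.mul_prod_erase _ _ (Finset.mem_range.2 hm)]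
      refine (mul_le_of_le_one_right (norm_nonneg _) ?_).trans h1
      exact Finset.prod_le_one (fun _ _ ↦ norm_nonneg _) fun i _ ↦ hP1 ξ i
    rw [norm_mul, mul_comm]
    gcongr

/-- On the dyadic interval from 2^(j+1) to 2^(j+2), monotonicity bounds the integrand below by
ψ(2^(j+1)) / 2^(2j+4); its length 2^(j+1) leaves the denominator 2^(j+3). -/
theorem summable_of_logIntegral_lt_top {ψ : ℝ → ℝ} (hψ0 : ∀ t ∈ Ici (0 : ℝ), 0 ≤ ψ t)
    (hmono : MonotoneOn ψ (Ici (0 : ℝ))) (hI : logIntegral ψ < ∞) :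
    Summable fun j : ℕ ↦ ψ (2 ^ (j + 1)) / 2 ^ j := by
  have hpos : ∀ k : ℕ, (0 : ℝ) < 2 ^ k := fun k ↦ by positivity
  have hle : ∑' j : ℕ, ENNReal.ofReal (ψ (2 ^ (j + 1)) / 2 ^ (j + 3)) ≤ logIntegral ψ := by
    have hmon : Monotone fun j : ℕ ↦ (2 : ℝ) ^ (j + 1) := fun i j hij ↦
      pow_le_pow_right₀ one_le_two (by omega)
    have h1 : ∫⁻ t in ⋃ j : ℕ, Ioc ((2 : ℝ) ^ (j + 1)) (2 ^ (j + 1 + 1)),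
        ENNReal.ofReal (ψ t / t ^ 2) ≤ logIntegral ψ := by
      refine lintegral_mono_set (iUnion_subset fun j t ht ↦ ?_)
      exact lt_of_le_of_lt (one_le_pow₀ one_le_two) ht.1
    rw [lintegral_iUnion (fun _ ↦ measurableSet_Ioc)
      (by simpa using! hmon.pairwise_disjoint_on_Ioc_succ)] at h1
    refine (ENNReal.tsum_le_tsum fun j ↦ ?_).trans h1
    calc ENNReal.ofReal (ψ (2 ^ (j + 1)) / 2 ^ (j + 3))
        = ∫⁻ t in Ioc ((2 : ℝ) ^ (j + 1)) (2 ^ (j + 1 + 1)),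
          ENNReal.ofReal (ψ (2 ^ (j + 1)) / (2 ^ (j + 1 + 1)) ^ 2) := by
          rw [setLIntegral_const, Real.volume_Ioc, ← ENNReal.ofReal_mul
            (div_nonneg (hψ0 _ (hpos _).le) (by positivity))]
          congr 1
          field_simp
          ring
      _ ≤ _ := by
          refine setLIntegral_mono' measurableSet_Ioc fun t ht ↦ ENNReal.ofReal_le_ofReal ?_
          have ht0 : 0 < t := (hpos _).trans ht.1
          have h2 : ψ (2 ^ (j + 1)) ≤ ψ t := hmono (hpos _).le ht0.le ht.1.le
          have h3 : 0 ≤ ψ t := hψ0 t ht0.le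
          have h4 := ht.2
          gcongr
  have h1 : Summable fun j : ℕ ↦ ψ (2 ^ (j + 1)) / 2 ^ (j + 3) := by
    have h2 := ENNReal.summable_toReal (hle.trans_lt hI).ne
    refine h2.congr fun j ↦ ?_
    exact ENNReal.toReal_ofReal (div_nonneg (hψ0 _ (hpos _).le) (hpos _).le)
  refine (h1.mul_left 8).congr fun j ↦ ?_
  rw [pow_add _ j 3]; field_simp; ring

theorem exists_continuous_compactSupport_decay (d : ℕ) {ψ : ℝ → ℝ}
    (hψ0 : ∀ t ∈ Ici (0 : ℝ), 0 ≤ ψ t) (hmono : MonotoneOn ψ (Ici (0 : ℝ)))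
    (hI : logIntegral ψ < ∞) :
    ∃ f : EuclideanSpace ℝ (Fin d) → ℂ, Continuous f ∧ HasCompactSupport f ∧ f ≠ 0 ∧
      (∀ q N : ℝ, 1 ≤ q → 0 ≤ N → ∀ η : EuclideanSpace ℝ (Fin d), ‖η‖ = 1 →
        WeightedLq ψ η q N (𝓕 f)) ∧
      (∀ N : ℝ, 0 ≤ N → ∃ C : ℝ, ∀ η : EuclideanSpace ℝ (Fin d), ‖η‖ = 1 →
        PointwiseDecay ψ η C N (𝓕 f)) := by
  have hsum : Summable fun j : ℕ ↦ (⌈ψ (2 ^ (j + 1))⌉₊ : ℝ) / 2 ^ j := by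
    -- Rounding up to an integer costs at most 1 per scale, that is, a geometric series.
    have h1 := (summable_of_logIntegral_lt_top hψ0 hmono hI).add summable_geometric_two
    refine Summable.of_nonneg_of_le (fun j ↦ by positivity) (fun j ↦ ?_) h1
    rw [one_div_pow, ← add_div]
    gcongr
    exact (Nat.ceil_lt_add_one (hψ0 _ (by positivity : (0 : ℝ) ≤ 2 ^ (j + 1)))).le
  obtain ⟨f, hfc, hfs, hf0, hf1, hf2⟩ :=
    exists_fourier_dyadic_decay (V := EuclideanSpace ℝ (Fin d)) _ hsum
  have key : ∀ η : EuclideanSpace ℝ (Fin d), ‖η‖ = 1 → ∀ ξ,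
      ‖𝓕 f ξ‖ * Real.exp (ψ |⟪ξ, η⟫|) ≤
        Real.exp (ψ 1) * ‖symbol (EuclideanSpace ℝ (Fin d)) ξ‖ := fun η hη ξ ↦ by
    have hle : |⟪ξ, η⟫| ≤ ‖ξ‖ := by simpa [hη] using abs_real_inner_le_norm ξ η
    have h1 : ψ |⟪ξ, η⟫| ≤ ψ ‖ξ‖ := hmono (mem_Ici.2 (abs_nonneg _)) (mem_Ici.2 (norm_nonneg ξ)) hle
    rcases lt_or_ge ‖ξ‖ 1 with hξ | hξ
    · have h2 : ψ ‖ξ‖ ≤ ψ 1 := hmono (mem_Ici.2 (norm_nonneg ξ)) (mem_Ici.2 zero_le_one) hξ.le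
      rw [mul_comm]
      exact mul_le_mul (Real.exp_le_exp.2 (h1.trans h2)) (hf1 ξ) (norm_nonneg _) (Real.exp_pos _).le
    -- For 2^j ≤ ‖ξ‖ < 2^(j+1) the decay at scale j must beat ψ at the upper endpoint, hence the
    -- exponent j + 1 in the choice of powers.
    · obtain ⟨j, hj1, hj2⟩ := exists_nat_pow_near hξ one_lt_two
      have h2 : ψ ‖ξ‖ ≤ ψ (2 ^ (j + 1)) :=
        hmono (mem_Ici.2 (norm_nonneg ξ)) (mem_Ici.2 (by positivity)) hj2.le
      have h3 := h1.trans (h2.trans (Nat.le_ceil _))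
      calc _ ≤ ‖symbol (EuclideanSpace ℝ (Fin d)) ξ‖ * Real.exp (-⌈ψ (2 ^ (j + 1))⌉₊) *
            Real.exp ⌈ψ (2 ^ (j + 1))⌉₊ := by
            gcongr
            exact hf2 j ξ hj1
        _ = ‖symbol (EuclideanSpace ℝ (Fin d)) ξ‖ := by
            rw [mul_assoc, ← Real.exp_add, neg_add_cancel, Real.exp_zero, mul_one]
        _ ≤ _ := le_mul_of_one_le_left (norm_nonneg _) (Real.one_le_exp (hψ0 1 (mem_Ici.2 zero_le_one)))
  -- The constant exp(ψ 1) accounts for the ball ‖ξ‖ < 1 and depends on neither `η` nor `N`.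
  refine ⟨f, hfc, hfs, hf0, fun q N hq hN η hη ↦ ?_, fun N hN ↦ ⟨Real.exp (ψ 1), fun η hη ↦
    Filter.Eventually.of_forall fun ξ ↦ ?_⟩⟩
  · have hq0 : 0 ≤ q := by linarith
    have hint : Integrable fun ξ : EuclideanSpace ℝ (Fin d) ↦
        Real.exp (ψ 1) ^ q * ‖symbol (EuclideanSpace ℝ (Fin d)) ξ‖ :=
      (SchwartzMap.integrable _).norm.const_mul _
    refine lt_of_le_of_lt (lintegral_mono fun ξ ↦ ENNReal.ofReal_le_ofReal ?_)
      (lt_top_iff_ne_top.2 ((lintegral_ofReal_ne_top_iff_integrable hint.aestronglyMeasurable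
        (Filter.Eventually.of_forall fun ξ ↦ by positivity)).2 hint))
    have h1 : (1 : ℝ) ≤ (1 + ‖ξ‖) ^ N :=
      Real.one_le_rpow (by linarith [norm_nonneg ξ]) hN
    have h2 : ‖𝓕 f ξ‖ ^ q * Real.exp (q * ψ |⟪ξ, η⟫|) =
        (‖𝓕 f ξ‖ * Real.exp (ψ |⟪ξ, η⟫|)) ^ q := by
      rw [Real.mul_rpow (norm_nonneg _) (Real.exp_pos _).le, ← Real.exp_mul, mul_comm q]
    calc _ ≤ ‖𝓕 f ξ‖ ^ q * Real.exp (q * ψ |⟪ξ, η⟫|) := div_le_self (by positivity) h1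
      _ ≤ (Real.exp (ψ 1) * ‖symbol (EuclideanSpace ℝ (Fin d)) ξ‖) ^ q := by
          rw [h2]
          exact Real.rpow_le_rpow (by positivity) (key η hη ξ) hq0
      _ ≤ _ := by
          rw [Real.mul_rpow (Real.exp_pos _).le (norm_nonneg _)]
          gcongr
          -- As the symbol is at most 1 and q ≥ 1, its integrability handles every q at once.
          exact Real.rpow_le_self_of_le_one (norm_nonneg _) (norm_symbol_le_one ξ) hq
  · have h1 : (1 : ℝ) ≤ (1 + ‖ξ‖) ^ N :=
      Real.one_le_rpow (by linarith [norm_nonneg ξ]) hN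
    have h2 := (key η hη ξ).trans
      (mul_le_mul_of_nonneg_left (norm_symbol_le_one ξ) (Real.exp_pos _).le)
    rw [Real.exp_neg, ← div_eq_mul_inv, le_div_iff₀ (Real.exp_pos _)]
    exact h2.trans (mul_le_mul_of_nonneg_left h1 (Real.exp_pos _).le)

end Existence

end PaleyWiener

end

theorem theorem2p3 (d : ℕ) (ψ : ℝ → ℝ) (hψ0 : ∀ t ∈ Set.Ici (0 : ℝ), 0 ≤ ψ t)
    (hψ : LocallyIntegrableOn ψ (Set.Ici (0 : ℝ)) volume) :
    (∀ (p : ℝ≥0∞) (hp1 : 1 ≤ p) (hp2 : p ≤ 2)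
      (f : Lp ℂ p (volume : Measure (EuclideanSpace ℝ (Fin d))))
      (η : EuclideanSpace ℝ (Fin d)) (s : ℝ),
      ‖η‖ = 1 →
      (∀ᵐ x : EuclideanSpace ℝ (Fin d), s < ⟪x, η⟫ → f x = 0) →
      ((∃ q N : ℝ, 1 ≤ q ∧ 0 ≤ N ∧
          PaleyWiener.WeightedLq ψ η q N (PaleyWiener.fourierLp hp1 hp2 f)) ∨
        (∃ C N : ℝ, 0 ≤ N ∧
          PaleyWiener.PointwiseDecay ψ η C N (PaleyWiener.fourierLp hp1 hp2 f))) →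
      PaleyWiener.logIntegral ψ = ∞ →
      f = 0) ∧
    (MonotoneOn ψ (Set.Ici (0 : ℝ)) → PaleyWiener.logIntegral ψ < ∞ →
      ∃ f : EuclideanSpace ℝ (Fin d) → ℂ, Continuous f ∧ HasCompactSupport f ∧ f ≠ 0 ∧
        (∀ q N : ℝ, 1 ≤ q → 0 ≤ N → ∀ η : EuclideanSpace ℝ (Fin d), ‖η‖ = 1 →
          PaleyWiener.WeightedLq ψ η q N (𝓕 f)) ∧
        (∀ N : ℝ, 0 ≤ N → ∃ C : ℝ, ∀ η : EuclideanSpace ℝ (Fin d), ‖η‖ = 1 →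
          PaleyWiener.PointwiseDecay ψ η C N (𝓕 f))) := by
  refine ⟨fun p hp1 hp2 f η s hη hf hdecay hI ↦ ?_, fun hmono hI ↦ ?_⟩
  · exact PaleyWiener.eq_zero_of_logIntegral_eq_top hψ0 hψ hp1 hp2 f hη hf hdecay hI
  · exact PaleyWiener.exists_continuous_compactSupport_decay d hψ0 hmono hI
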